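/- Let $\mathrm{SU}(2)$ act on $\mathbb{C}P^1$ (the lines in $\mathbb{C}^2$) and let $T=\{(l,v)\in\mathbb{C}P^1\times\mathbb{C}^2 : v\in l\}$ be the tautological bundle. Let $\Gamma$ be the space of continuous sections $s$ of $T$ (so $s(l)\in l$ for every line $l$), with the action $(g\cdot s)(l)=g\,s(g^{-1}l)$. For $k\ge 1$ let $\Gamma^{2k}\subset\Gamma$ be the isotypic component of type $S^{2k-1}(\mathbb{C}^2)$, i.e. the sum of all $\mathrm{SU}(2)$-invariant subspaces isomorphic to $S^{2k-1}(\mathbb{C}^2)$. Put $H=\sum_{k=1}^5\Gamma^{2k}$, and for a line $l$ let $e_l:\Gamma\to l$, $e_l(s)=s(l)$. For a finite set $X\subset\mathbb{C}P^1$ and linear maps $\lambda_x:x\to\Gamma^2$ ($x\in X$) put $\Psi_{(X,\lambda)}=\sum_{x\in X}\lambda_x\circ e_x$; for a linear map $\tau:H\to\Gamma^2$, the pair $(X,\lambda)$ is called a $\tau$-design if $\tau(s)=\Psi_{(X,\lambda)}(s)$ for all $s\in H$. For $g\in\mathrm{SU}(2)$ and $\lambda:l\to\Gamma^2$ let $g\cdot\lambda:gl\to\Gamma^2$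 be $(g\cdot\lambda)(z)=g\cdot\lambda(g^{-1}z)$. The sum of two pairs has the union of the two point sets as its point set, and the maps are added at common points; put $G\cdot(X,\lambda)=\sum_{g\in G}(gX,g\lambda)$ for a finite subgroup $G$ of $\mathrm{SU}(2)$; a scalar multiplies the maps of a pair. Let $\varepsilon$ be a primitive fifth root of unity and let $G=G_{\mathrm{icosa}}=\langle S,T_0,U\rangle\subset\mathrm{SU}(2)$ with $$S=\begin{pmatrix}\varepsilon^3&0\\0&\varepsilon^2\end{pmatrix},\quad T_0=\frac1{\varepsilon^2-\varepsilon^3}\begin{pmatrix}\varepsilon+\varepsilon^4&1\\1&-\varepsilon-\varepsilon^4\end{pmatrix},\quad U=\begin{pmatrix}0&1\\-1&0\end{pmatrix}.$$ Let $x_0=\{(x,0):x\in\mathbb{C}\}\in\mathbb{C}P^1$ and let $\lambda_0:x_0\to\Gamma^2$ be given by $\lambda_0(z,0)(l)=2\,\mathrm{pr}_l(z,0)$, where $\mathrm{pr}_l$ is the orthogonal projection of $\mathbb{C}^2$ onto $l$. Then: 1. $\Psi_{(\{x_0\},\lambda_0)}=\lambda_0\circ e_{x_0}$, regarded as an endomorphism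 of $H$, has trace $2$. 2. $G$ has order $120$, the stabilizer $G_{x_0}$ of $x_0$ in $G$ has order $10$, and $k\cdot\lambda_0=\lambda_0$ for every $k\in G_{x_0}$; the set $G/G_{x_0}$ has a complete set of representatives $g_1,\dots,g_{12}$. 3. $H=\Gamma^2\oplus\bigl(\sum_{k=2}^5\Gamma^{2k}\bigr)$; let $\tau:H\to\Gamma^2$ be the corresponding projection. The pair $\frac1{|G|}\,G\cdot(\{x_0\},\lambda_0)$ is a $\tau$-design, and for all $s\in H$ $$\tau(s)=\frac1{120}\sum_{g\in G}(g\cdot\lambda_0)\bigl(e_{gx_0}(s)\bigr).$$ 4. For every complete set of representatives $g_1,\dots,g_{12}$ of $G/G_{x_0}$, put $x_i=g_ix_0$ and $\lambda_i=g_i\cdot\lambda_0$. The $x_i$ are pairwise distinct and form the orbit $Gx_0$; the pair $\frac1{|G|}\,G\cdot(\{x_0\},\lambda_0)$ has the point set $\{x_1,\dots,x_{12}\}$ and the map $\frac1{12}\lambda_i$ at $x_i$; and for all $s\in H$ $$\tau(s)=\frac1{12}\sum_{i=1}^{12}\lambda_i\bigl(e_{x_i}(s)\bigr).$$ -/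

import Mathlib

open scoped LinearAlgebra.Projectivization Matrix

noncomputable section

namespace TauDesign

/-! ### The general notion of a `τ`-design -/

/-- `(X, {lam x}_{x ∈ X})` is a `τ`-design: `τ s = ∑_{x ∈ X} lam x (e x s)` for all `s ∈ H₀`. -/
def IsTauDesign {Ω : Type*} {W H : Type*} [AddCommGroup W] [Module ℂ W]
    [AddCommGroup H] [Module ℂ H] (H₀ : Submodule ℂ H)
    {V : Ω → Type*} [∀ p, AddCommGroup (V p)] [∀ p, Module ℂ (V p)]
    (e : ∀ p, H →ₗ[ℂ] V p) (τ : H₀ →ₗ[ℂ] W)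
    (X : Finset Ω) (lam : ∀ x : X, V x →ₗ[ℂ] W) : Prop :=
  ∀ s : H₀, τ s = ∑ x : X, lam x (e x (s : H))

/-! ### `SU(2)` acting on `ℂ²` and on the projective line -/

/-- `ℂ²` with its standard Hermitian inner product. -/
abbrev C2 : Type := EuclideanSpace ℂ (Fin 2)

/-- The group `SU(2)`. -/
abbrev SU2 : Type := Matrix.specialUnitaryGroup (Fin 2) ℂ

/-- The complex projective line: the lines in `ℂ²`. -/
abbrev CP1 : Type := ℙ ℂ C2

/-- The fibre over `l` of the tautological bundle `{(l, v) | v ∈ l}`, that is, `l` itself. -/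
abbrev fiber (l : CP1) : Submodule ℂ C2 := l.submodule

/-- `SU(2)` acts on `ℂ²` by `g • v = g v` (matrix times column vector). -/
instance : @DistribMulAction SU2 C2 DivInvMonoid.toMonoid _ where
  smul g v := WithLp.toLp 2 ((g : Matrix (Fin 2) (Fin 2) ℂ) *ᵥ v.ofLp)
  one_smul v := by
    change WithLp.toLp 2 ((1 : Matrix (Fin 2) (Fin 2) ℂ) *ᵥ v.ofLp) = v
    simp
  mul_smul g h v := by
    change WithLp.toLp 2 (((g : Matrix (Fin 2) (Fin 2) ℂ) * (h : Matrix (Fin 2) (Fin 2) ℂ)) *ᵥ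
      v.ofLp) = WithLp.toLp 2 ((g : Matrix (Fin 2) (Fin 2) ℂ) *ᵥ
        ((h : Matrix (Fin 2) (Fin 2) ℂ) *ᵥ v.ofLp))
    rw [Matrix.mulVec_mulVec]
  smul_zero g := by
    change WithLp.toLp 2 ((g : Matrix (Fin 2) (Fin 2) ℂ) *ᵥ (0 : Fin 2 → ℂ)) = 0
    simp
  smul_add g v w := by
    change WithLp.toLp 2 ((g : Matrix (Fin 2) (Fin 2) ℂ) *ᵥ (v.ofLp + w.ofLp)) =
      WithLp.toLp 2 ((g : Matrix (Fin 2) (Fin 2) ℂ) *ᵥ v.ofLp) +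
      WithLp.toLp 2 ((g : Matrix (Fin 2) (Fin 2) ℂ) *ᵥ w.ofLp)
    rw [Matrix.mulVec_add, WithLp.toLp_add]

theorem smul_def (g : SU2) (v : C2) :
    g • v = WithLp.toLp 2 ((g : Matrix (Fin 2) (Fin 2) ℂ) *ᵥ v.ofLp) := rfl

instance : SMulCommClass SU2 ℂ C2 where
  smul_comm g c v := by
    simp only [smul_def, WithLp.ofLp_smul, Matrix.mulVec_smul, WithLp.toLp_smul]

/-- The linear map `v ↦ g • v`. -/
def vecAct (g : SU2) : C2 →ₗ[ℂ] C2 where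
  toFun v := g • v
  map_add' := smul_add g
  map_smul' := smul_comm g

/-- `SU(2)` acts on lines by `g • l = {g v | v ∈ l}`. -/
instance : @MulAction SU2 CP1 DivInvMonoid.toMonoid where
  smul g l := l.map (vecAct g) (MulAction.injective g)
  one_smul l := by
    induction l using Projectivization.ind with
    | h w hw =>
      change Projectivization.mk ℂ ((1 : SU2) • w) _ = _
      simp only [one_smul]
  mul_smul g h l := by
    induction l using Projectivization.ind with
    | h w hw =>
      change Projectivization.mk ℂ ((g * h) • w) _ = Projectivization.mk ℂ (g • h • w) _
      simp only [mul_smul]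

theorem smul_ne_zero_of (g : SU2) {v : C2} (hv : v ≠ 0) : g • v ≠ 0 :=
  (smul_ne_zero_iff_ne g).mpr hv

theorem smul_mk (g : SU2) {v : C2} (hv : v ≠ 0) :
    g • Projectivization.mk ℂ v hv =
      Projectivization.mk ℂ (g • v) (smul_ne_zero_of g hv) := rfl

theorem fiber_mk {w : C2} (hw : w ≠ 0) :
    fiber (Projectivization.mk ℂ w hw) = Submodule.span ℂ {w} :=
  Projectivization.submodule_mk w hw

theorem smul_mem_fiber (g : SU2) {l : CP1} {v : C2} (hv : v ∈ fiber l) :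
    g • v ∈ fiber (g • l) := by
  induction l using Projectivization.ind with
  | h w hw =>
    rw [smul_mk]
    rw [fiber_mk, Submodule.mem_span_singleton] at hv ⊢
    obtain ⟨c, rfl⟩ := hv
    exact ⟨c, (smul_comm g c w).symm⟩

theorem inv_smul_mem_fiber (g : SU2) {l : CP1} {v : C2} (hv : v ∈ fiber (g • l)) :
    g⁻¹ • v ∈ fiber l := by
  have h := smul_mem_fiber g⁻¹ hv
  rwa [inv_smul_smul] at h

theorem smul_mem_fiber_of_inv (g : SU2) {l : CP1} {v : C2} (hv : v ∈ fiber (g⁻¹ • l)) :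
    g • v ∈ fiber l := by
  have h := smul_mem_fiber g hv
  rwa [smul_inv_smul] at h

theorem continuous_smul (g : SU2) : Continuous fun v : C2 => g • v := by
  have : (fun v : C2 => g • v) =
      fun v => (Matrix.toEuclideanLin (g : Matrix (Fin 2) (Fin 2) ℂ)) v := by
    ext v; rfl
  rw [this]
  exact LinearMap.continuous_of_finiteDimensional _

theorem inner_smul_smul (g : SU2) (v w : C2) : inner ℂ (g • v) (g • w) = inner ℂ v w := by
  have h : (star (g : Matrix (Fin 2) (Fin 2) ℂ)) * g = 1 :=
    (Matrix.mem_unitaryGroup_iff'.mp (Matrix.mem_specialUnitaryGroup_iff.mp g.2).1)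
  simp only [smul_def, EuclideanSpace.inner_eq_star_dotProduct, Matrix.star_mulVec]
  rw [dotProduct_comm, ← Matrix.dotProduct_mulVec, Matrix.mulVec_mulVec]
  rw [← Matrix.star_eq_conjTranspose, h, Matrix.one_mulVec, dotProduct_comm]

/-! ### Sections of the tautological bundle -/

/-- The space `Γ` of continuous sections `s`, `s l ∈ l`, of the tautological bundle. Since the
projective line carries the quotient topology of `ℂ² ∖ 0`, a section is continuous iff
`v ↦ s [v]` is continuous on `ℂ² ∖ 0`. -/
def Sec : Submodule ℂ (∀ l : CP1, fiber l) where
  carrier := {s | Continuous fun v : {v : C2 // v ≠ 0} =>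
    ((s (Projectivization.mk ℂ v.1 v.2) : fiber _) : C2)}
  add_mem' := fun hs ht => Continuous.add hs ht
  zero_mem' := continuous_const
  smul_mem' := fun c _ hs => Continuous.const_smul hs c

/-- The evaluation `e_l : s ↦ s(l) ∈ l`. -/
def eval (l : CP1) : Sec →ₗ[ℂ] fiber l :=
  LinearMap.proj l ∘ₗ Sec.subtype

@[ext]
theorem sec_ext {s t : Sec} (h : ∀ l, (eval l s : C2) = eval l t) : s = t := by
  apply Subtype.ext
  funext l
  exact Subtype.ext (h l)

/-- The action of `g ∈ SU(2)` on sections: `(g • s)(l) = g (s (g⁻¹ l))`. -/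
def secAct (g : SU2) : Sec →ₗ[ℂ] Sec where
  toFun s := ⟨fun l => ⟨g • ((s.1 (g⁻¹ • l) : fiber _) : C2),
      smul_mem_fiber_of_inv g (s.1 (g⁻¹ • l)).2⟩, by
    have h : Continuous fun v : {v : C2 // v ≠ 0} =>
        (⟨g⁻¹ • v.1, smul_ne_zero_of g⁻¹ v.2⟩ : {v : C2 // v ≠ 0}) :=
      ((continuous_smul g⁻¹).comp continuous_subtype_val).subtype_mk _
    exact (continuous_smul g).comp (Continuous.comp (g := fun v : {v : C2 // v ≠ 0} =>
      ((s.1 (Projectivization.mk ℂ v.1 v.2) : fiber _) : C2)) s.2 h)⟩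
  map_add' s t := by
    ext l : 1
    exact smul_add g _ _
  map_smul' c s := by
    ext l : 1
    exact smul_comm g c _

theorem eval_secAct (g : SU2) (s : Sec) (l : CP1) :
    (eval l (secAct g s) : C2) = g • (eval (g⁻¹ • l) s : C2) := rfl

/-- `Γ` as a representation of `SU(2)`. -/
def secRep : Representation ℂ SU2 Sec where
  toFun := secAct
  map_one' := by
    refine LinearMap.ext fun s => ?_
    ext l : 1
    rw [eval_secAct, one_smul, inv_one]
    simp only [Module.End.one_apply]
    rw [one_smul]
  map_mul' g h := by
    refine LinearMap.ext fun s => ?_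
    ext l : 1
    rw [Module.End.mul_apply, eval_secAct, eval_secAct, eval_secAct, mul_smul, mul_inv_rev,
      mul_smul]

/-! ### The symmetric powers of `ℂ²` and the decomposition of `Γ` -/

/-- The action of `g` on the symmetric algebra `ℂ[X₀, X₁]` of `ℂ²`, where `X₀, X₁` is the standard
basis of `ℂ²`: `g X_j = ∑ i, g_{ij} X_i`. -/
def symAlgAct (g : SU2) : MvPolynomial (Fin 2) ℂ →ₐ[ℂ] MvPolynomial (Fin 2) ℂ :=
  MvPolynomial.aeval fun j => ∑ i, MvPolynomial.C ((g : Matrix (Fin 2) (Fin 2) ℂ) i j) *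
    MvPolynomial.X i

theorem symAlgAct_one : symAlgAct 1 = AlgHom.id ℂ _ := by
  apply MvPolynomial.algHom_ext
  intro j
  fin_cases j <;> simp [symAlgAct]

theorem symAlgAct_mul (g h : SU2) : symAlgAct (g * h) = (symAlgAct g).comp (symAlgAct h) := by
  apply MvPolynomial.algHom_ext
  intro j
  simp [symAlgAct, Matrix.mul_apply, Fin.sum_univ_two, MvPolynomial.algHom_C,
    MvPolynomial.algebraMap_eq]
  ring

theorem symAlgAct_mem (g : SU2) (n : ℕ) :
    ∀ p ∈ MvPolynomial.homogeneousSubmodule (Fin 2) ℂ n,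
      (symAlgAct g).toLinearMap p ∈ MvPolynomial.homogeneousSubmodule (Fin 2) ℂ n := by
  intro p hp
  rw [MvPolynomial.mem_homogeneousSubmodule] at hp ⊢
  have := hp.aeval (fun j => ∑ i, MvPolynomial.C ((g : Matrix (Fin 2) (Fin 2) ℂ) i j) *
    MvPolynomial.X i) (n := 1) (fun j => MvPolynomial.IsHomogeneous.sum _ _ _ fun i _ => by
      simpa using (MvPolynomial.isHomogeneous_C (Fin 2)
        ((g : Matrix (Fin 2) (Fin 2) ℂ) i j)).mul (MvPolynomial.isHomogeneous_X ℂ i))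
  simpa [symAlgAct] using this

/-- The `n`-th symmetric power `Sⁿ(ℂ²)` as a representation of `SU(2)`. -/
def symRep (n : ℕ) : Representation ℂ SU2 (MvPolynomial.homogeneousSubmodule (Fin 2) ℂ n) where
  toFun g := (symAlgAct g).toLinearMap.restrict (symAlgAct_mem g n)
  map_one' := by
    refine LinearMap.ext fun p => Subtype.ext ?_
    simp [LinearMap.restrict_apply, symAlgAct_one]
  map_mul' g h := by
    refine LinearMap.ext fun p => Subtype.ext ?_
    simp [LinearMap.restrict_apply, symAlgAct_mul]

/-- `Γ^{2k}` (for `k ≥ 1`): the isotypic component of type `S^{2k-1}(ℂ²)` of `Γ`, that is, the sum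
of all `SU(2)`-invariant subspaces of `Γ` that are isomorphic to `S^{2k-1}(ℂ²)`. -/
def Gam (k : ℕ) : Submodule ℂ Sec :=
  ⨆ W : {W : Subrepresentation secRep //
    Nonempty (W.toRepresentation.Equiv (symRep (2 * k - 1)))}, W.1.toSubmodule

/-- `H = ⨁_{k=1}^5 Γ^{2k}`, as a subspace of `Γ`. -/
def Hsp : Submodule ℂ Sec := ⨆ k ∈ Finset.Icc 1 5, Gam k

/-- The sum `⨁_{k=2}^5 Γ^{2k}`. -/
def Hhigh : Submodule ℂ Sec := ⨆ k ∈ Finset.Icc 2 5, Gam k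

theorem Gam_one_le : Gam 1 ≤ Hsp := le_iSup₂_of_le 1 (by simp) le_rfl

/-- The projection `τ : H → Γ²` along `⨁_{k=2}^5 Γ^{2k}`. -/
def tau (h : IsCompl ((Gam 1).submoduleOf Hsp) (Hhigh.submoduleOf Hsp)) : Hsp →ₗ[ℂ] Gam 1 :=
  (Submodule.submoduleOfEquivOfLe Gam_one_le).toLinearMap ∘ₗ 
    by exact Submodule.projectionOnto (R := ℂ) (E := Hsp) ((Gam 1).submoduleOf Hsp) (Hhigh.submoduleOf Hsp) h

theorem secAct_mem_Gam (g : SU2) (k : ℕ) : ∀ s ∈ Gam k, secAct g s ∈ Gam k := by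
  intro s hs
  have h : Gam k ≤ (Gam k).comap (secAct g) := by
    conv_lhs => rw [Gam]
    refine iSup_le fun W s hs => ?_
    exact (le_iSup (fun W : {W : Subrepresentation secRep //
      Nonempty (W.toRepresentation.Equiv (symRep (2 * k - 1)))} => W.1.toSubmodule) W)
      (W.1.apply_mem_toSubmodule g hs)
  exact h hs

/-- The action of `g` on `Γ²`. -/
def gamAct (g : SU2) : Gam 1 →ₗ[ℂ] Gam 1 := (secAct g).restrict (secAct_mem_Gam g 1)

/-! ### Pairs `(X, λ)` -/

/-- For `lam : l → Γ²`, the map `g • lam : g l → Γ²`, `z ↦ g • lam (g⁻¹ z)`. -/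
def actLam (g : SU2) {l : CP1} (lam : fiber l →ₗ[ℂ] Gam 1) : fiber (g • l) →ₗ[ℂ] Gam 1 where
  toFun z := gamAct g (lam ⟨g⁻¹ • (z : C2), inv_smul_mem_fiber g z.2⟩)
  map_add' z w := by
    rw [← map_add, ← map_add]
    congr 2
    exact Subtype.ext (smul_add g⁻¹ _ _)
  map_smul' c z := by
    rw [RingHom.id_apply, ← map_smul, ← map_smul]
    congr 2
    exact Subtype.ext (smul_comm g⁻¹ c _)

/-- A pair `(X, {lam x}_{x ∈ X})`: a finite set of points of the projective line and a linear map
`lam x : x → Γ²` for each of them. -/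
structure DPair where
  /-- the finite set of points -/
  X : Finset CP1
  /-- the linear maps -/
  lam : ∀ x : X, fiber x →ₗ[ℂ] Gam 1

namespace DPair

/-- `Ψ_{(X, λ)}(s) = ∑_{x ∈ X} λ_x (e_x s)`. -/
def Psi (P : DPair) : Sec →ₗ[ℂ] Gam 1 := ∑ x : P.X, P.lam x ∘ₗ eval x

/-- `Ψ_{(X, λ)}` as an endomorphism of `H`. -/
def PsiEnd (P : DPair) : Hsp →ₗ[ℂ] Hsp :=
  Submodule.inclusion Gam_one_le ∘ₗ P.Psi ∘ₗ Hsp.subtype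

open Classical in
/-- The extension of `λ` by zero to all points. -/
def ext0 (P : DPair) (y : CP1) : fiber y →ₗ[ℂ] Gam 1 :=
  if h : y ∈ P.X then P.lam ⟨y, h⟩ else 0

theorem ext0_of_mem (P : DPair) {y : CP1} (h : y ∈ P.X) : P.ext0 y = P.lam ⟨y, h⟩ := dif_pos h

theorem ext0_of_notMem (P : DPair) {y : CP1} (h : y ∉ P.X) : P.ext0 y = 0 := dif_neg h

theorem ext_of {P Q : DPair} (hX : P.X = Q.X) (h : ∀ y, P.ext0 y = Q.ext0 y) : P = Q := by
  obtain ⟨X, lam⟩ := P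
  obtain ⟨Y, mu⟩ := Q
  obtain rfl : X = Y := hX
  congr 1
  funext x
  have := h x.1
  rwa [ext0_of_mem _ x.2, ext0_of_mem _ x.2] at this

open Classical in
/-- The sum of pairs: the union of the sets of points, with the maps added where both are given. -/
instance : Add DPair where
  add P Q := ⟨P.X ∪ Q.X, fun x => P.ext0 x + Q.ext0 x⟩

/-- The empty pair. -/
instance : Zero DPair where
  zero := ⟨∅, fun _ => 0⟩

open Classical in
theorem add_X (P Q : DPair) : (P + Q).X = P.X ∪ Q.X := rfl

theorem zero_X : (0 : DPair).X = ∅ := rfl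

theorem add_ext0 (P Q : DPair) (y : CP1) : (P + Q).ext0 y = P.ext0 y + Q.ext0 y := by
  classical
  by_cases h : y ∈ P.X ∪ Q.X
  · exact ext0_of_mem (P + Q) (by rwa [add_X])
  · rw [ext0_of_notMem _ (by rwa [add_X])]
    rw [Finset.mem_union, not_or] at h
    rw [ext0_of_notMem _ h.1, ext0_of_notMem _ h.2, add_zero]

theorem zero_ext0 (y : CP1) : (0 : DPair).ext0 y = 0 :=
  ext0_of_notMem _ (by simp [zero_X])

instance : AddCommMonoid DPair where
  add_assoc P Q R := by
    classical
    exact ext_of (by simp only [add_X, Finset.union_assoc])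
      fun y => by simp only [add_ext0, add_assoc]
  zero_add P := ext_of (by simp [add_X, zero_X]) fun y => by simp [add_ext0, zero_ext0]
  add_zero P := ext_of (by simp [add_X, zero_X]) fun y => by simp [add_ext0, zero_ext0]
  add_comm P Q := by
    classical
    exact ext_of (by simp only [add_X, Finset.union_comm])
      fun y => by simp only [add_ext0, add_comm]
  nsmul := nsmulRec

/-- Multiplication of the maps of a pair by a scalar. -/
def scale (c : ℂ) (P : DPair) : DPair := ⟨P.X, fun x => c • P.lam x⟩

open Classical in
/-- The pair `(g X, g λ)`; the map at `y ∈ g X` is `z ↦ g • λ_{g⁻¹ y} (g⁻¹ z)`. -/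
def act (g : SU2) (P : DPair) : DPair where
  X := P.X.image (g • ·)
  lam y :=
    { toFun := fun z => gamAct g (P.ext0 (g⁻¹ • y.1) ⟨g⁻¹ • (z : C2), smul_mem_fiber g⁻¹ z.2⟩)
      map_add' := fun z w => by
        rw [← map_add, ← map_add]
        congr 2
        exact Subtype.ext (smul_add g⁻¹ _ _)
      map_smul' := fun c z => by
        rw [RingHom.id_apply, ← map_smul, ← map_smul]
        congr 2
        exact Subtype.ext (smul_comm g⁻¹ c _) }

/-- The orbit sum `G · (X, λ) = ∑_{g ∈ G} (g X, g λ)` for a finite group `G`. -/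
def orbitSum (G : Subgroup SU2) (P : DPair) : DPair := ∑ᶠ g : G, P.act (g : SU2)

end DPair

/-! ### The binary icosahedral group -/

theorem star_of_primitive {ε : ℂ} (hε : IsPrimitiveRoot ε 5) : (starRingEnd ℂ) ε = ε ^ 4 := by
  have h1 : ε * (starRingEnd ℂ) ε = 1 := by
    rw [Complex.mul_conj, Complex.normSq_eq_norm_sq, hε.norm'_eq_one (by norm_num)]
    norm_num
  have h2 : ε * ε ^ 4 = 1 := by rw [← hε.pow_eq_one]; ring
  exact mul_left_cancel₀ (hε.ne_zero (by norm_num)) (h1.trans h2.symm)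

theorem sum_of_primitive {ε : ℂ} (hε : IsPrimitiveRoot ε 5) :
    1 + ε + ε ^ 2 + ε ^ 3 + ε ^ 4 = 0 := by
  have := hε.geom_sum_eq_zero (by norm_num)
  simpa [Finset.sum_range_succ] using this

theorem sub_ne_zero_of_primitive {ε : ℂ} (hε : IsPrimitiveRoot ε 5) : ε ^ 2 - ε ^ 3 ≠ 0 := by
  intro h
  have h0 : ε ≠ 0 := hε.ne_zero (by norm_num)
  have h1 : ε ≠ 1 := hε.ne_one (by norm_num)
  have : ε ^ 2 * (1 - ε) = 0 := by rw [← h]; ring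
  rcases mul_eq_zero.mp this with h2 | h2
  · exact h0 (pow_eq_zero_iff (by norm_num) |>.mp h2)
  · exact h1 (sub_eq_zero.mp h2).symm

/-- `S = diag(ε³, ε²)`. -/
def icosaS (ε : ℂ) (hε : IsPrimitiveRoot ε 5) : SU2 :=
  ⟨!![ε ^ 3, 0; 0, ε ^ 2], by
    have h5 : ε ^ 5 = 1 := hε.pow_eq_one
    rw [Matrix.mem_specialUnitaryGroup_iff, Matrix.mem_unitaryGroup_iff]
    constructor
    · ext i j
      fin_cases i <;> fin_cases j <;>
        simp [Matrix.mul_apply, Fin.sum_univ_two, Matrix.star_apply, star_of_primitive hε]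
      · linear_combination (ε ^ 10 + ε ^ 5 + 1) * h5
      · linear_combination (ε ^ 5 + 1) * h5
    · rw [Matrix.det_fin_two_of]
      linear_combination h5⟩

/-- `T = (ε² - ε³)⁻¹ [[ε + ε⁴, 1], [1, -ε - ε⁴]]`. -/
def icosaT (ε : ℂ) (hε : IsPrimitiveRoot ε 5) : SU2 :=
  ⟨(1 / (ε ^ 2 - ε ^ 3)) • !![ε + ε ^ 4, 1; 1, -ε - ε ^ 4], by
    have h5 : ε ^ 5 = 1 := hε.pow_eq_one
    have hs := sum_of_primitive hε
    have hd := sub_ne_zero_of_primitive hε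
    have e8 : ε ^ 8 = ε ^ 3 := by linear_combination ε ^ 3 * h5
    have e12 : ε ^ 12 = ε ^ 2 := by linear_combination (ε ^ 7 + ε ^ 2) * h5
    have e16 : ε ^ 16 = ε := by linear_combination (ε ^ 11 + ε ^ 6 + ε) * h5
    have hc : (starRingEnd ℂ) (ε ^ 2 - ε ^ 3) = -(ε ^ 2 - ε ^ 3) := by
      simp only [map_sub, map_pow, star_of_primitive hε, ← pow_mul]
      norm_num [e8, e12]
    have ha : (starRingEnd ℂ) (ε + ε ^ 4) = ε + ε ^ 4 := by
      simp only [map_add, map_pow, star_of_primitive hε, ← pow_mul]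
      norm_num [e16]
      ring
    have hkey : (ε + ε ^ 4) ^ 2 + 1 = -(ε ^ 2 - ε ^ 3) ^ 2 := by
      linear_combination (ε ^ 3 + 2 * ε ^ 0 - 2 + ε) * h5 + hs
    have hM : (!![ε + ε ^ 4, 1; 1, -ε - ε ^ 4] : Matrix (Fin 2) (Fin 2) ℂ) =
        !![ε + ε ^ 4, 1; 1, -(ε + ε ^ 4)] := by
      rw [neg_add, sub_eq_add_neg]
    rw [hM]
    generalize ε + ε ^ 4 = a at *
    generalize ε ^ 2 - ε ^ 3 = d at *
    rw [Matrix.mem_specialUnitaryGroup_iff, Matrix.mem_unitaryGroup_iff]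
    constructor
    · ext i j
      fin_cases i <;> fin_cases j <;>
        simp [Matrix.mul_apply, Fin.sum_univ_two, Matrix.star_apply, ha, hc] <;>
        field_simp <;>
        first | ring1 | linear_combination hkey | linear_combination -hkey
    · rw [Matrix.det_smul, Matrix.det_fin_two_of]
      simp only [Fintype.card_fin]
      field_simp
      linear_combination -hkey⟩

/-- `U = [[0, 1], [-1, 0]]`. -/
def icosaU : SU2 :=
  ⟨!![0, 1; -1, 0], by
    rw [Matrix.mem_specialUnitaryGroup_iff, Matrix.mem_unitaryGroup_iff]
    constructor
    · ext i j
      fin_cases i <;> fin_cases j <;>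
        simp [Matrix.mul_apply, Fin.sum_univ_two, Matrix.star_apply]
    · simp [Matrix.det_fin_two_of]⟩

/-- The binary icosahedral group `⟨S, T, U⟩ ⊆ SU(2)`. -/
def icosa (ε : ℂ) (hε : IsPrimitiveRoot ε 5) : Subgroup SU2 :=
  Subgroup.closure {icosaS ε hε, icosaT ε hε, icosaU}

/-! ### The base point and the base map -/

/-- The line `x₀ = {(x, 0)}`. -/
def x0 : CP1 := Projectivization.mk ℂ (EuclideanSpace.single 0 1 : C2) (by simp)

/-- The section `l ↦ pr_l v`, where `pr_l` is the orthogonal projection onto the line `l`. -/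
def prSec : C2 →ₗ[ℂ] Sec where
  toFun v := ⟨fun l => (fiber l).orthogonalProjectionOnto v, by
    have h : ∀ w : {w : C2 // w ≠ 0},
        (((fiber (Projectivization.mk ℂ w.1 w.2)).orthogonalProjectionOnto v : fiber _) : C2) =
          (inner ℂ w.1 v / ((‖w.1‖ : ℂ) ^ 2)) • w.1 := by
      intro w
      rw [← Submodule.starProjection_apply]
      simp only [fiber, Projectivization.submodule_mk]
      rw [Submodule.starProjection_singleton]
      norm_cast
    change Continuous fun w : {w : C2 // w ≠ 0} => _
    simp_rw [h]
    have h1 : Continuous fun w : {w : C2 // w ≠ 0} => inner ℂ w.1 v := by fun_prop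
    have h2 : Continuous fun w : {w : C2 // w ≠ 0} => (‖w.1‖ : ℂ) ^ 2 := by fun_prop
    exact (h1.div h2 fun w => by simpa using w.2).smul continuous_subtype_val⟩
  map_add' v w := by
    ext l : 1
    exact congrArg Subtype.val (map_add (fiber l).orthogonalProjectionOnto v w)
  map_smul' c v := by
    ext l : 1
    exact congrArg Subtype.val (map_smul (fiber l).orthogonalProjectionOnto c v)

theorem eval_prSec (v : C2) (l : CP1) :
    eval l (prSec v) = (fiber l).orthogonalProjectionOnto v := rfl

theorem secAct_prSec (g : SU2) (v : C2) : secAct g (prSec v) = prSec (g • v) := by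
  ext l : 1
  rw [eval_secAct, eval_prSec, eval_prSec, ← Submodule.starProjection_apply,
    ← Submodule.starProjection_apply]
  refine (Submodule.eq_starProjection_of_mem_of_inner_eq_zero ?_ ?_).symm
  · exact smul_mem_fiber_of_inv g (Submodule.starProjection_apply_mem _ _)
  · intro w hw
    have hw' := smul_mem_fiber g⁻¹ hw
    have h1 : g • v - g • (fiber (g⁻¹ • l)).starProjection v =
        g • (v - (fiber (g⁻¹ • l)).starProjection v) := (smul_sub _ _ _).symm
    rw [h1, ← inner_smul_smul g⁻¹, inv_smul_smul]
    exact Submodule.starProjection_inner_eq_zero v _ hw'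

theorem prSec_injective : Function.Injective prSec := by
  rw [injective_iff_map_eq_zero]
  intro v hv
  by_contra h0
  have h1 := congrArg (fun s => (eval (Projectivization.mk ℂ v h0) s : C2)) hv
  simp only [eval_prSec, map_zero, Submodule.coe_zero] at h1
  rw [← Submodule.starProjection_apply, Submodule.starProjection_eq_self_iff.mpr] at h1
  · exact h0 h1
  · rw [fiber_mk]
    exact Submodule.mem_span_singleton_self v

/-- The identification of `ℂ²` with the linear forms, `v ↦ v₀ X₀ + v₁ X₁`. -/
def linForm : C2 →ₗ[ℂ] MvPolynomial.homogeneousSubmodule (Fin 2) ℂ (2 * 1 - 1) where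
  toFun v := ⟨∑ i, MvPolynomial.C (v i) * MvPolynomial.X i, by
    rw [MvPolynomial.mem_homogeneousSubmodule]
    exact MvPolynomial.IsHomogeneous.sum _ _ _ fun i _ => by
      simpa using (MvPolynomial.isHomogeneous_C (Fin 2) (v i)).mul
        (MvPolynomial.isHomogeneous_X ℂ i)⟩
  map_add' v w := Subtype.ext <| by
    simp [Fin.sum_univ_two]
    ring
  map_smul' c v := Subtype.ext <| by
    simp [Fin.sum_univ_two, MvPolynomial.smul_eq_C_mul]
    ring

theorem linForm_bijective : Function.Bijective linForm := by
  constructor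
  · rw [injective_iff_map_eq_zero]
    intro v hv
    have h := congrArg Subtype.val hv
    simp only [linForm, LinearMap.coe_mk, AddHom.coe_mk, Submodule.coe_zero] at h
    ext i
    have h2 := congrArg (MvPolynomial.eval (Pi.single i 1)) h
    fin_cases i <;> simpa [Pi.single_apply] using h2
  · rintro ⟨p, hp⟩
    have hp' : p ∈ MvPolynomial.homogeneousSubmodule (Fin 2) ℂ 1 := hp
    rw [MvPolynomial.homogeneousSubmodule_one_eq_span_X,
      Submodule.mem_span_range_iff_exists_fun] at hp'
    obtain ⟨c, rfl⟩ := hp'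
    refine ⟨WithLp.toLp 2 c, Subtype.ext ?_⟩
    simp [linForm, MvPolynomial.smul_eq_C_mul]

theorem symRep_linForm (g : SU2) (v : C2) :
    symRep (2 * 1 - 1) g (linForm v) = linForm (g • v) := by
  apply Subtype.ext
  change symAlgAct g (∑ i, MvPolynomial.C (v i) * MvPolynomial.X i) =
    ∑ i, MvPolynomial.C ((g • v : C2) i) * MvPolynomial.X i
  simp [symAlgAct, smul_def, Fin.sum_univ_two, MvPolynomial.algHom_C,
    MvPolynomial.algebraMap_eq]
  ring

theorem prSec_mem_Gam (v : C2) : prSec v ∈ Gam 1 := by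
  let W : Subrepresentation secRep :=
    { toSubmodule := LinearMap.range prSec
      apply_mem_toSubmodule := by
        rintro g _ ⟨w, rfl⟩
        exact ⟨g • w, (secAct_prSec g w).symm⟩ }
  let e₁ : C2 ≃ₗ[ℂ] LinearMap.range prSec := LinearEquiv.ofInjective prSec prSec_injective
  let e₂ : C2 ≃ₗ[ℂ] MvPolynomial.homogeneousSubmodule (Fin 2) ℂ (2 * 1 - 1) :=
    LinearEquiv.ofBijective linForm linForm_bijective
  have hW : Nonempty (W.toRepresentation.Equiv (symRep (2 * 1 - 1))) := by
    refine ⟨Representation.Equiv.mk (e₁.symm.trans e₂) fun g => LinearMap.ext fun x => ?_⟩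
    obtain ⟨w, rfl⟩ := e₁.surjective x
    have h1 : W.toRepresentation g (e₁ w) = e₁ (g • w) := Subtype.ext (secAct_prSec g w)
    change e₂ (e₁.symm (W.toRepresentation g (e₁ w))) =
      symRep (2 * 1 - 1) g (e₂ (e₁.symm (e₁ w)))
    rw [h1, LinearEquiv.symm_apply_apply, LinearEquiv.symm_apply_apply]
    exact (symRep_linForm g w).symm
  exact (le_iSup (fun W : {W : Subrepresentation secRep //
    Nonempty (W.toRepresentation.Equiv (symRep (2 * 1 - 1)))} => W.1.toSubmodule) ⟨W, hW⟩)
    ⟨v, rfl⟩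

/-- `λ₀ : x₀ → Γ²`, `λ₀(z, 0)(l) = 2 pr_l (z, 0)`. -/
def lam0 : fiber x0 →ₗ[ℂ] Gam 1 :=
  (2 : ℂ) • (prSec.codRestrict (Gam 1) prSec_mem_Gam ∘ₗ (fiber x0).subtype)

/-- The pair `({x}, lam)`. -/
def DPair.single (x : CP1) (lam : fiber x →ₗ[ℂ] Gam 1) : DPair where
  X := {x}
  lam y := lam ∘ₗ LinearMap.restrict LinearMap.id (fun v hv => by
    have h : y.1 = x := Finset.mem_singleton.mp y.2
    have hv' : v ∈ fiber y.1 := hv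
    rw [h] at hv'
    exact hv')

/-- The pair `(X, λ)` is a `τ`-design for `τ : H → Γ²`. -/
def DPair.IsDesign (P : DPair) (τ : Hsp →ₗ[ℂ] Gam 1) : Prop :=
  IsTauDesign (W := Gam 1) (V := fun l => fiber l) Hsp eval τ P.X P.lam

/-- The averaged orbit sum `(1/|G|) G · ({x₀}, λ₀)` for the binary icosahedral group `G`. -/
def icosaPair (ε : ℂ) (hε : IsPrimitiveRoot ε 5) : DPair :=
  ((DPair.single x0 lam0).orbitSum (icosa ε hε)).scale (1 / (Nat.card (icosa ε hε) : ℂ))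

end TauDesign

end

open TauDesign

open scoped LinearAlgebra.Projectivization Matrix

noncomputable section

namespace TauDesign

/-! Orthogonal projection commutes with unitary maps, so `g • λ₀` is `twoPr (g • x₀)` and depends
only on the point `g • x₀`. The averaged operator is therefore `(2 / 120) • prSec (E s)`, where `E s
= ∑_g s(g x₀)` is `orbitEval`, a `G`-equivariant map from `Γ` to `ℂ²`. The design property amounts
to two facts about `E`.

On `Γ²`, which is the range of `prSec` (`Gam_one_eq`), one has `E (prSec v) = 60 v`
(`orbitEval_prSec`): `E ∘ prSec` commutes with `S` and `U`, hence is a scalar, and its trace is a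
sum of 120 traces of rank-one projections.

On `Γ^{2k}` with `2 ≤ k ≤ 5`, `E` vanishes (`Gam_le_ker_orbitEval`), since no nonzero
`G`-equivariant map from `S³`, `S⁵`, `S⁷` or `S⁹` to `ℂ²` exists. Weights under `S` leave at most
two unknown coefficients in each coordinate, and equivariance under `T` kills them. The same two
facts show that `Γ²` meets the sum of the higher components only in zero.

The order of `G` comes from a normal form for words in `S`, `T`, `U`: the orbit of `x₀` has 12
points and its stabilizer is cyclic of order 10. The trace is computed from `tr(AB) = tr(BA)` on the
line `x₀`. This needs `H` finite-dimensional, which follows from Frobenius reciprocity: an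
intertwiner from `S^{2k+1}` to `Γ` is determined by one number, its value at `x₀` on `X₀^{k+1}
X₁^k`. -/

/-! ### The maps `λ_y(z) = 2 pr(z)` -/

/-- The linear map `y → Γ²`, `z ↦ (l ↦ 2 pr_l z)`. -/
def twoPr (y : CP1) : fiber y →ₗ[ℂ] Gam 1 :=
  (2 : ℂ) • (prSec.codRestrict (Gam 1) prSec_mem_Gam ∘ₗ (fiber y).subtype)

theorem coe_twoPr (y : CP1) (z : fiber y) : (twoPr y z : Sec) = (2 : ℂ) • prSec z := rfl

theorem lam0_eq_twoPr : lam0 = twoPr x0 := rfl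

/-- Two unrelated fibres are allowed, with only the underlying vectors compared, so that no
transport along an equality of lines is needed. -/
theorem gamAct_twoPr (g : SU2) {y y' : CP1} (z : fiber y) (w : fiber y')
    (h : (w : C2) = g • (z : C2)) : gamAct g (twoPr y z) = twoPr y' w := by
  apply Subtype.ext
  change secAct g ((2 : ℂ) • prSec z) = (2 : ℂ) • prSec w
  rw [map_smul, secAct_prSec, h]

theorem actLam_twoPr (g : SU2) (l : CP1) : actLam g (twoPr l) = twoPr (g • l) := by
  refine LinearMap.ext fun z => ?_
  exact gamAct_twoPr g _ _ (smul_inv_smul g _).symm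

theorem actLam_lam0 (g : SU2) : actLam g lam0 = twoPr (g • x0) := actLam_twoPr g x0

theorem eval_secAct_smul (g : SU2) (s : Sec) (l : CP1) :
    (eval (g • l) (secAct g s) : C2) = g • (eval l s : C2) := by
  rw [eval_secAct, inv_smul_smul]

theorem eval_congr {l l' : CP1} (h : l = l') (s : Sec) : (eval l s : C2) = eval l' s := by
  rw [h]

/-! ### Pairs described point by point -/

namespace DPair

-- After extension by zero all maps live over one fixed fibre `y`, so sums and translates of pairs
-- can be compared there.
open Classical in
theorem single_ext0 (x y : CP1) :
    (single x (twoPr x)).ext0 y = if y = x then twoPr y else 0 := by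
  split_ifs with h
  · rw [ext0_of_mem (P := single x (twoPr x)) (h := Finset.mem_singleton.mpr h)]
    rfl
  · exact ext0_of_notMem _ fun h' => h (Finset.mem_singleton.mp h')

theorem act_ext0 (g : SU2) (P : DPair) (y : CP1) (z : fiber y) :
    (P.act g).ext0 y z =
      gamAct g (P.ext0 (g⁻¹ • y) ⟨g⁻¹ • (z : C2), smul_mem_fiber g⁻¹ z.2⟩) := by
  classical
  by_cases h : y ∈ (P.act g).X
  · rw [ext0_of_mem _ h]
    rfl
  · rw [ext0_of_notMem _ h, ext0_of_notMem P, LinearMap.zero_apply, LinearMap.zero_apply, map_zero]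
    intro h'
    refine h (Finset.mem_image.mpr ⟨_, h', ?_⟩)
    exact smul_inv_smul g y

open Classical in
theorem act_single_ext0 (g : SU2) (x y : CP1) :
    ((single x (twoPr x)).act g).ext0 y = if g • x = y then twoPr y else 0 := by
  refine LinearMap.ext fun z => ?_
  rw [act_ext0, single_ext0]
  have h : g⁻¹ • y = x ↔ g • x = y := by
    rw [inv_smul_eq_iff, eq_comm]
  simp only [h]
  split_ifs
  · exact gamAct_twoPr g _ _ (smul_inv_smul g _).symm
  · exact map_zero _

theorem sum_ext0 {ι : Type*} (t : Finset ι) (P : ι → DPair) (y : CP1) :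
    (∑ i ∈ t, P i).ext0 y = ∑ i ∈ t, (P i).ext0 y := by
  classical
  induction t using Finset.induction_on with
  | empty => simp [zero_ext0]
  | insert i t hi ih => rw [Finset.sum_insert hi, Finset.sum_insert hi, add_ext0, ih]

theorem mem_sum_X {ι : Type*} (t : Finset ι) (P : ι → DPair) (y : CP1) :
    y ∈ (∑ i ∈ t, P i).X ↔ ∃ i ∈ t, y ∈ (P i).X := by
  classical
  induction t using Finset.induction_on with
  | empty => simp [zero_X]
  | insert i t hi ih =>
    rw [Finset.sum_insert hi, add_X, Finset.mem_union, ih]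
    simp

theorem mem_act_single_X (g : SU2) (x y : CP1) (lam : fiber x →ₗ[ℂ] Gam 1) :
    y ∈ ((single x lam).act g).X ↔ g • x = y := by
  classical
  change y ∈ Finset.image (g • ·) {x} ↔ _
  simp [eq_comm]

theorem lam_eq_ext0 (P : DPair) (x : P.X) : P.lam x = P.ext0 x := (ext0_of_mem P x.2).symm

end DPair

/-! ### The averaged orbit sum and evaluation along the orbit -/

theorem mem_icosaPair_X {ε : ℂ} (hε : IsPrimitiveRoot ε 5) [Finite (icosa ε hε)] (y : CP1) :
    y ∈ (icosaPair ε hε).X ↔ y ∈ MulAction.orbit (icosa ε hε) x0 := by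
  have := Fintype.ofFinite (icosa ε hε)
  change y ∈ (DPair.orbitSum _ _).X ↔ _
  rw [DPair.orbitSum, finsum_eq_sum_of_fintype, DPair.mem_sum_X]
  simp only [Finset.mem_univ, true_and, DPair.mem_act_single_X]
  rfl

/-- The elements taking `x` to `h • x` form the left coset of the stabilizer through `h`. -/
theorem card_transporter {G α : Type*} [Group G] [MulAction G α] (x : α) (h : G) :
    Nat.card {g : G // g • x = h • x} = Nat.card (MulAction.stabilizer G x) := by
  refine Nat.card_congr ⟨fun g => ⟨h⁻¹ * g.1, ?_⟩, fun k => ⟨h * k.1, ?_⟩, ?_, ?_⟩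
  · rw [MulAction.mem_stabilizer_iff, mul_smul, inv_smul_eq_iff]
    exact g.2
  · rw [mul_smul, MulAction.mem_stabilizer_iff.mp k.2]
  · intro g; simp
  · intro g; simp

open Classical in
theorem orbitSum_ext0 (G : Subgroup SU2) [Fintype G] (x y : CP1) :
    ((DPair.single x (twoPr x)).orbitSum G).ext0 y =
      (Finset.univ.filter fun g : G => (g : SU2) • x = y).card • twoPr y := by
  rw [DPair.orbitSum, finsum_eq_sum_of_fintype, DPair.sum_ext0]
  simp only [DPair.act_single_ext0]
  rw [← Finset.sum_filter, Finset.sum_const]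

/-- Each orbit point is reached by 10 group elements, all contributing the same map, and `10 / 120 =
1 / 12`. -/
theorem icosaPair_lam {ε : ℂ} (hε : IsPrimitiveRoot ε 5) (hG : Nat.card (icosa ε hε) = 120)
    (hS : Nat.card (MulAction.stabilizer (icosa ε hε) x0) = 10) (y : (icosaPair ε hε).X) :
    (icosaPair ε hε).lam y = (1 / 12 : ℂ) • twoPr y := by
  classical
  have : Finite (icosa ε hε) := Nat.finite_of_card_ne_zero (by rw [hG]; norm_num)
  have := Fintype.ofFinite (icosa ε hε)
  obtain ⟨y, hy⟩ := y
  obtain ⟨h, rfl⟩ := (mem_icosaPair_X hε y).mp hy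
  have h1 : (icosaPair ε hε).lam ⟨_, hy⟩ = (1 / (Nat.card (icosa ε hε) : ℂ)) •
      ((DPair.single x0 lam0).orbitSum (icosa ε hε)).lam ⟨_, hy⟩ := rfl
  have h2 : (Finset.univ.filter fun g : icosa ε hε => (g : SU2) • x0 = h • x0).card = 10 := by
    rw [← hS, ← card_transporter x0 h, Nat.card_eq_fintype_card, Fintype.card_subtype]
    rfl
  have h3 : ((DPair.single x0 lam0).orbitSum (icosa ε hε)).ext0 (h • x0) =
      10 • twoPr (h • x0) := by
    rw [lam0_eq_twoPr, orbitSum_ext0, h2]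
  rw [h1, DPair.lam_eq_ext0]
  change _ • ((DPair.single x0 lam0).orbitSum (icosa ε hε)).ext0 (h • x0) =
    _ • twoPr (h • x0)
  rw [h3, ← Nat.cast_smul_eq_nsmul ℂ, smul_smul, hG]
  norm_num

theorem sum_icosa_smul {M : Type*} [AddCommMonoid M] {ε : ℂ} (hε : IsPrimitiveRoot ε 5)
    [Fintype (icosa ε hε)] (hS : Nat.card (MulAction.stabilizer (icosa ε hε) x0) = 10)
    (F : CP1 → M) :
    ∑ g : icosa ε hε, F ((g : SU2) • x0) = 10 • ∑ y ∈ (icosaPair ε hε).X, F y := by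
  classical
  rw [← Finset.sum_fiberwise_of_maps_to (t := (icosaPair ε hε).X)
    (g := fun g : icosa ε hε => (g : SU2) • x0) (fun g _ => (mem_icosaPair_X hε _).mpr ⟨g, rfl⟩),
    Finset.smul_sum]
  refine Finset.sum_congr rfl fun y hy => ?_
  obtain ⟨h, rfl⟩ := (mem_icosaPair_X hε y).mp hy
  rw [Finset.sum_congr rfl (g := fun _ => F (h • x0)), Finset.sum_const, ← hS,
    ← card_transporter x0 h, Nat.card_eq_fintype_card, Fintype.card_subtype]
  · rfl
  · intro g hg
    rw [(Finset.mem_filter.mp hg).2]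

/-- The operator `s ↦ ∑_{g ∈ G} s(g x₀)`. -/
def orbitEval (G : Subgroup SU2) [Fintype G] : Sec →ₗ[ℂ] C2 :=
  ∑ g : G, (fiber ((g : SU2) • x0)).subtype ∘ₗ eval ((g : SU2) • x0)

theorem orbitEval_apply (G : Subgroup SU2) [Fintype G] (s : Sec) :
    orbitEval G s = ∑ g : G, (eval ((g : SU2) • x0) s : C2) := by
  simp [orbitEval]

/-- Reindex the sum by `g ↦ h * g`. -/
theorem orbitEval_secAct (G : Subgroup SU2) [Fintype G] (h : G) (s : Sec) :
    orbitEval G (secAct h s) = (h : SU2) • orbitEval G s := by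
  change _ = vecAct h (orbitEval G s)
  rw [orbitEval_apply, orbitEval_apply, map_sum, ← Equiv.sum_comp (Equiv.mulLeft h)]
  refine Finset.sum_congr rfl fun g _ => ?_
  change _ = (h : SU2) • (eval ((g : SU2) • x0) s : C2)
  rw [← eval_secAct_smul]
  exact eval_congr (mul_smul _ _ _) _

/-- The orbit sum factors through `ℂ²`, so its study reduces to `orbitEval`. -/
theorem sum_twoPr (G : Subgroup SU2) [Fintype G] (s : Sec) :
    ((∑ g : G, twoPr ((g : SU2) • x0) (eval ((g : SU2) • x0) s) : Gam 1) : Sec) =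
      (2 : ℂ) • prSec (orbitEval G s) := by
  rw [orbitEval_apply, map_sum, Finset.smul_sum]
  simp [coe_twoPr]

theorem sum_icosaPair {ε : ℂ} (hε : IsPrimitiveRoot ε 5) [Fintype (icosa ε hε)]
    (hG : Nat.card (icosa ε hε) = 120)
    (hS : Nat.card (MulAction.stabilizer (icosa ε hε) x0) = 10) (s : Sec) :
    ∑ x : (icosaPair ε hε).X, (icosaPair ε hε).lam x (eval x s) =
      (1 / 120 : ℂ) • ∑ g : icosa ε hε, twoPr ((g : SU2) • x0) (eval ((g : SU2) • x0) s) := by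
  rw [sum_icosa_smul (M := Gam 1) hε hS fun y => twoPr y (eval y s), 
    ← Finset.sum_coe_sort _ (fun y => twoPr y (eval y s)),
    ← Nat.cast_smul_eq_nsmul ℂ, smul_smul, Finset.smul_sum]
  refine Finset.sum_congr rfl fun x _ => ?_
  rw [icosaPair_lam hε hG hS, LinearMap.smul_apply]
  norm_num

/-! ### Relations in the binary icosahedral group -/

theorem matrix_fin_two_congr {R : Type*} {a b c d a' b' c' d' : R} (ha : a = a') (hb : b = b')
    (hc : c = c') (hd : d = d') : !![a, b; c, d] = !![a', b'; c', d'] := by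
  rw [ha, hb, hc, hd]

theorem coe_icosaS {ε : ℂ} (hε : IsPrimitiveRoot ε 5) :
    (icosaS ε hε : Matrix (Fin 2) (Fin 2) ℂ) = !![ε ^ 3, 0; 0, ε ^ 2] := rfl

theorem coe_icosaS_pow {ε : ℂ} (hε : IsPrimitiveRoot ε 5) (m : ℕ) :
    ((icosaS ε hε ^ m : SU2) : Matrix (Fin 2) (Fin 2) ℂ) =
      !![ε ^ (3 * m), 0; 0, ε ^ (2 * m)] := by
  induction m with
  | zero => simp [Matrix.one_fin_two]
  | succ m ih =>
    rw [pow_succ, Submonoid.coe_mul, ih, coe_icosaS, Matrix.mul_fin_two]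
    refine matrix_fin_two_congr ?_ ?_ ?_ ?_ <;> ring

theorem coe_icosaT {ε : ℂ} (hε : IsPrimitiveRoot ε 5) :
    (icosaT ε hε : Matrix (Fin 2) (Fin 2) ℂ) =
      !![1 / (ε ^ 2 - ε ^ 3) * (ε + ε ^ 4), 1 / (ε ^ 2 - ε ^ 3);
        1 / (ε ^ 2 - ε ^ 3), -(1 / (ε ^ 2 - ε ^ 3) * (ε + ε ^ 4))] := by
  change (1 / (ε ^ 2 - ε ^ 3)) • !![ε + ε ^ 4, 1; 1, -ε - ε ^ 4] = _
  rw [Matrix.smul_of, Matrix.smul_cons, Matrix.smul_cons]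
  simp only [Matrix.smul_cons, smul_eq_mul, Matrix.smul_empty]
  refine matrix_fin_two_congr ?_ ?_ ?_ ?_ <;> ring

theorem coe_icosaU : (icosaU : Matrix (Fin 2) (Fin 2) ℂ) = !![0, 1; -1, 0] := rfl

theorem coe_icosaU_pow_two :
    ((icosaU ^ 2 : SU2) : Matrix (Fin 2) (Fin 2) ℂ) = !![-1, 0; 0, -1] := by
  rw [pow_two, Submonoid.coe_mul, coe_icosaU, Matrix.mul_fin_two]
  refine matrix_fin_two_congr ?_ ?_ ?_ ?_ <;> ring

theorem coe_icosaU_pow_three :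
    ((icosaU ^ 3 : SU2) : Matrix (Fin 2) (Fin 2) ℂ) = !![0, -1; 1, 0] := by
  rw [pow_succ, Submonoid.coe_mul, coe_icosaU_pow_two, coe_icosaU, Matrix.mul_fin_two]
  refine matrix_fin_two_congr ?_ ?_ ?_ ?_ <;> ring

theorem icosaU_pow_four : icosaU ^ 4 = 1 := by
  apply Subtype.ext
  rw [pow_succ, Submonoid.coe_mul, coe_icosaU_pow_three, coe_icosaU, Matrix.mul_fin_two,
    Submonoid.coe_one, Matrix.one_fin_two]
  refine matrix_fin_two_congr ?_ ?_ ?_ ?_ <;> ring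

theorem icosaS_pow_five {ε : ℂ} (hε : IsPrimitiveRoot ε 5) : icosaS ε hε ^ 5 = 1 := by
  have h5 : ε ^ 5 = 1 := hε.pow_eq_one
  apply Subtype.ext
  rw [coe_icosaS_pow, Submonoid.coe_one, Matrix.one_fin_two]
  refine matrix_fin_two_congr ?_ rfl rfl ?_
  · rw [mul_comm, pow_mul, h5, one_pow]
  · rw [mul_comm, pow_mul, h5, one_pow]

theorem icosaS_mul_U {ε : ℂ} (hε : IsPrimitiveRoot ε 5) :
    icosaS ε hε * icosaU = icosaU * icosaS ε hε ^ 4 := by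
  have h5 : ε ^ 5 = 1 := hε.pow_eq_one
  apply Subtype.ext
  rw [Submonoid.coe_mul, Submonoid.coe_mul, coe_icosaS_pow, coe_icosaS, coe_icosaU,
    Matrix.mul_fin_two, Matrix.mul_fin_two]
  refine matrix_fin_two_congr ?_ ?_ ?_ ?_
  · ring
  · linear_combination -ε ^ 3 * h5
  · linear_combination (ε ^ 2 + ε ^ 7) * h5
  · ring

theorem icosaT_mul_U {ε : ℂ} (hε : IsPrimitiveRoot ε 5) :
    icosaT ε hε * icosaU = icosaU ^ 3 * icosaT ε hε := by
  apply Subtype.ext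
  rw [Submonoid.coe_mul, Submonoid.coe_mul, coe_icosaT, coe_icosaU_pow_three, coe_icosaU,
    Matrix.mul_fin_two, Matrix.mul_fin_two]
  refine matrix_fin_two_congr ?_ ?_ ?_ ?_ <;> ring

theorem icosaT_mul_T {ε : ℂ} (hε : IsPrimitiveRoot ε 5) :
    icosaT ε hε * icosaT ε hε = icosaU ^ 2 := by
  have h5 : ε ^ 5 = 1 := hε.pow_eq_one
  have hs := sum_of_primitive hε
  have hc := one_div_mul_cancel (sub_ne_zero_of_primitive hε)
  apply Subtype.ext
  rw [Submonoid.coe_mul, coe_icosaT, coe_icosaU_pow_two, Matrix.mul_fin_two]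
  generalize 1 / (ε ^ 2 - ε ^ 3) = c at hc ⊢
  have h : c ^ 2 * ((ε + ε ^ 4) ^ 2 + 1) = -1 := by
    linear_combination c ^ 2 * (ε ^ 3 + ε) * h5 + c ^ 2 * hs -
      (c * (ε ^ 2 - ε ^ 3) + 1) * hc
  refine matrix_fin_two_congr ?_ ?_ ?_ ?_
  · linear_combination h
  · ring
  · ring
  · linear_combination h

/-- This and the next three relations, with `icosaT_mul_T`, rewrite any word containing two letters
`T` so that at most one remains. -/
theorem icosaT_S_pow_1_T {ε : ℂ} (hε : IsPrimitiveRoot ε 5) :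
    icosaT ε hε * icosaS ε hε ^ 1 * icosaT ε hε =
      icosaU * icosaS ε hε ^ 4 * icosaT ε hε * icosaS ε hε ^ 1 := by
  have hs := sum_of_primitive hε
  have hc := one_div_mul_cancel (sub_ne_zero_of_primitive hε)
  apply Subtype.ext
  simp only [Submonoid.coe_mul, coe_icosaT, coe_icosaS_pow, coe_icosaU,
    Matrix.mul_fin_two]
  -- Each entry becomes a polynomial identity in `ε` and `c`, a consequence of `1 + ε + ε² + ε³ + ε⁴
  -- = 0` and `c (ε² - ε³) = 1`.
  generalize 1 / (ε ^ 2 - ε ^ 3) = c at hc ⊢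
  refine matrix_fin_two_congr ?_ ?_ ?_ ?_
  · linear_combination c ^ 2 * (ε ^ 2 - ε ^ 3 + ε ^ 5 - ε ^ 6 + ε ^ 7 + ε ^ 8 - 2 * ε ^ 9 + ε ^
      10) * hs + c * (ε ^ 11) * hc
  · linear_combination c ^ 2 * (-ε ^ 3 + 2 * ε ^ 4 - ε ^ 5 - ε ^ 6 + 2 * ε ^ 7 - 2 * ε ^ 8 + 2 *
      ε ^ 9 - ε ^ 10 - ε ^ 11 + 2 * ε ^ 12 - ε ^ 13) * hs + c * (-ε ^ 11 - ε ^ 14) * hc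
  · linear_combination c ^ 2 * (-ε ^ 3 + 2 * ε ^ 4 - ε ^ 5 - ε ^ 6 + 2 * ε ^ 7 - 2 * ε ^ 8 + 2 *
      ε ^ 9 - ε ^ 10 - ε ^ 11 + 2 * ε ^ 12 - 2 * ε ^ 13 + 2 * ε ^ 14 - ε ^ 15 - ε ^ 16 + 2 * ε ^
      17 - ε ^ 18) * hs + c * (-ε ^ 16 - ε ^ 19) * hc
  · linear_combination c ^ 2 * (ε ^ 3 - ε ^ 5 + 2 * ε ^ 7 - ε ^ 8 - ε ^ 11 + 2 * ε ^ 12 - ε ^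
      13) * hs + c * (-ε ^ 14) * hc

theorem icosaT_S_pow_2_T {ε : ℂ} (hε : IsPrimitiveRoot ε 5) :
    icosaT ε hε * icosaS ε hε ^ 2 * icosaT ε hε =
      icosaS ε hε ^ 3 * icosaT ε hε * icosaS ε hε ^ 3 := by
  have hs := sum_of_primitive hε
  have hc := one_div_mul_cancel (sub_ne_zero_of_primitive hε)
  apply Subtype.ext
  simp only [Submonoid.coe_mul, coe_icosaT, coe_icosaS_pow, Matrix.mul_fin_two]
  generalize 1 / (ε ^ 2 - ε ^ 3) = c at hc ⊢
  refine matrix_fin_two_congr ?_ ?_ ?_ ?_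
  · linear_combination c ^ 2 * (ε ^ 4 - ε ^ 5 + ε ^ 8 - ε ^ 10 + 2 * ε ^ 11 - 2 * ε ^ 12 + ε ^
      13 + ε ^ 14 - 2 * ε ^ 15 + 2 * ε ^ 16 - 2 * ε ^ 17 + ε ^ 18 + ε ^ 19 - 2 * ε ^ 20 + ε ^ 21)
      * hs + c * (ε ^ 19 + ε ^ 22) * hc
  · linear_combination c ^ 2 * (-ε ^ 5 + ε ^ 6 + ε ^ 7 - 2 * ε ^ 8 + ε ^ 9 + ε ^ 12 - 2 * ε ^ 13
      + ε ^ 14) * hs + c * (ε ^ 15) * hc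
  · linear_combination c ^ 2 * (-ε ^ 5 + ε ^ 6 + ε ^ 7 - 2 * ε ^ 8 + ε ^ 9 + ε ^ 12 - 2 * ε ^ 13
      + ε ^ 14) * hs + c * (ε ^ 15) * hc
  · linear_combination c ^ 2 * (2 * ε ^ 6 - 2 * ε ^ 7 + 2 * ε ^ 9 - 2 * ε ^ 10 + 2 * ε ^ 11 - ε
      ^ 12 - ε ^ 13 + 2 * ε ^ 14 - ε ^ 15) * hs + c * (-ε ^ 13 - ε ^ 16) * hc

theorem icosaT_S_pow_3_T {ε : ℂ} (hε : IsPrimitiveRoot ε 5) :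
    icosaT ε hε * icosaS ε hε ^ 3 * icosaT ε hε =
      icosaU ^ 2 * icosaS ε hε ^ 2 * icosaT ε hε * icosaS ε hε ^ 2 := by
  have hs := sum_of_primitive hε
  have hc := one_div_mul_cancel (sub_ne_zero_of_primitive hε)
  apply Subtype.ext
  simp only [Submonoid.coe_mul, coe_icosaT, coe_icosaS_pow, coe_icosaU_pow_two,
    Matrix.mul_fin_two]
  generalize 1 / (ε ^ 2 - ε ^ 3) = c at hc ⊢
  refine matrix_fin_two_congr ?_ ?_ ?_ ?_
  · linear_combination c ^ 2 * (ε ^ 6 - ε ^ 7 + 2 * ε ^ 11 - 2 * ε ^ 12 + 2 * ε ^ 14 - ε ^ 15) *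
      hs + c * (-ε ^ 13 - ε ^ 16) * hc
  · linear_combination c ^ 2 * (-ε ^ 7 + ε ^ 8) * hs + c * (-ε ^ 10) * hc
  · linear_combination c ^ 2 * (-ε ^ 7 + ε ^ 8) * hs + c * (-ε ^ 10) * hc
  · linear_combination c ^ 2 * (ε ^ 8 - ε ^ 10 + ε ^ 11) * hs + c * (ε ^ 9 + ε ^ 12) * hc

theorem icosaT_S_pow_4_T {ε : ℂ} (hε : IsPrimitiveRoot ε 5) :
    icosaT ε hε * icosaS ε hε ^ 4 * icosaT ε hε =
      icosaU ^ 3 * icosaS ε hε ^ 1 * icosaT ε hε * icosaS ε hε ^ 4 := by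
  have hs := sum_of_primitive hε
  have hc := one_div_mul_cancel (sub_ne_zero_of_primitive hε)
  apply Subtype.ext
  simp only [Submonoid.coe_mul, coe_icosaT, coe_icosaS_pow, coe_icosaU_pow_three,
    Matrix.mul_fin_two]
  generalize 1 / (ε ^ 2 - ε ^ 3) = c at hc ⊢
  refine matrix_fin_two_congr ?_ ?_ ?_ ?_
  · linear_combination c ^ 2 * (ε ^ 8 - ε ^ 9 + ε ^ 13 - ε ^ 15 + ε ^ 16) * hs + c * (-ε ^ 14) *
      hc
  · linear_combination c ^ 2 * (-ε ^ 9 + ε ^ 10 - ε ^ 12 + ε ^ 13) * hs + c * (ε ^ 11 + ε ^ 14)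
      * hc
  · linear_combination c ^ 2 * (-ε ^ 9 + ε ^ 10 - ε ^ 12 + 2 * ε ^ 13 - 2 * ε ^ 14 + ε ^ 15 + ε
      ^ 16 - 2 * ε ^ 17 + ε ^ 18) * hs + c * (ε ^ 16 + ε ^ 19) * hc
  · linear_combination c ^ 2 * (ε ^ 10 - ε ^ 11 + ε ^ 12) * hs + c * (ε ^ 11) * hc

/-! ### The elements of the binary icosahedral group -/

section Group

variable {ε : ℂ} (hε : IsPrimitiveRoot ε 5)

/-- Conjugation by `U` inverts `S`; the inverse is written `S ^ 4` to keep exponents natural, whence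
the factor `4 ^ j`. -/
theorem icosaS_pow_mul_U_pow (m j : ℕ) :
    icosaS ε hε ^ m * icosaU ^ j = icosaU ^ j * icosaS ε hε ^ (m * 4 ^ j) := by
  induction j generalizing m with
  | zero => simp
  | succ j ih =>
    have h : SemiconjBy icosaU (icosaS ε hε ^ 4) (icosaS ε hε) := (icosaS_mul_U hε).symm
    have h2 : icosaU * icosaS ε hε ^ (4 * (m * 4 ^ j)) = icosaS ε hε ^ (m * 4 ^ j) * icosaU := by
      rw [pow_mul]
      exact h.pow_right _
    rw [pow_succ, ← mul_assoc, ih, mul_assoc, ← h2, mul_assoc]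
    congr 3
    ring

theorem icosaT_mul_U_pow (j : ℕ) :
    icosaT ε hε * icosaU ^ j = icosaU ^ (3 * j) * icosaT ε hε := by
  rw [pow_mul]
  exact ((show SemiconjBy (icosaT ε hε) icosaU (icosaU ^ 3) from icosaT_mul_U hε).pow_right j)

theorem icosaS_pow_mod (m : ℕ) : icosaS ε hε ^ m = icosaS ε hε ^ (m % 5) := by
  conv_lhs => rw [← Nat.mod_add_div m 5, pow_add, pow_mul, icosaS_pow_five, one_pow, mul_one]

theorem icosaU_pow_mod (m : ℕ) : icosaU ^ m = icosaU ^ (m % 4) := by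
  conv_lhs => rw [← Nat.mod_add_div m 4, pow_add, pow_mul, icosaU_pow_four, one_pow, mul_one]

/-- `g` is of the form `U^j S^m` or `U^j S^m T S^n`. -/
def IsIcosaWord (g : SU2) : Prop :=
  (∃ j m : ℕ, g = icosaU ^ j * icosaS ε hε ^ m) ∨
    ∃ j m n : ℕ, g = icosaU ^ j * icosaS ε hε ^ m * icosaT ε hε * icosaS ε hε ^ n

variable {hε}

theorem IsIcosaWord.U_pow_mul {g : SU2} (hg : IsIcosaWord hε g) (k : ℕ) :
    IsIcosaWord hε (icosaU ^ k * g) := by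
  rcases hg with ⟨j, m, rfl⟩ | ⟨j, m, n, rfl⟩
  · exact Or.inl ⟨k + j, m, by simp only [pow_add, mul_assoc]⟩
  · exact Or.inr ⟨k + j, m, n, by simp only [pow_add, mul_assoc]⟩

theorem IsIcosaWord.mul_S_pow {g : SU2} (hg : IsIcosaWord hε g) (k : ℕ) :
    IsIcosaWord hε (g * icosaS ε hε ^ k) := by
  rcases hg with ⟨j, m, rfl⟩ | ⟨j, m, n, rfl⟩
  · exact Or.inl ⟨j, m + k, by simp only [pow_add, mul_assoc]⟩
  · exact Or.inr ⟨j, m, n + k, by simp only [pow_add, mul_assoc]⟩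

theorem IsIcosaWord.S_mul {g : SU2} (hg : IsIcosaWord hε g) :
    IsIcosaWord hε (icosaS ε hε * g) := by
  have h (j : ℕ) : icosaS ε hε * icosaU ^ j = icosaU ^ j * icosaS ε hε ^ (4 ^ j) := by
    simpa using icosaS_pow_mul_U_pow hε 1 j
  rcases hg with ⟨j, m, rfl⟩ | ⟨j, m, n, rfl⟩
  · exact Or.inl ⟨j, 4 ^ j + m, by rw [← mul_assoc, h, pow_add, mul_assoc]⟩
  · exact Or.inr ⟨j, 4 ^ j + m, n, by simp only [← mul_assoc, h, pow_add]⟩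

variable (hε) in
theorem isIcosaWord_T_S_pow_T (m : ℕ) :
    IsIcosaWord hε (icosaT ε hε * icosaS ε hε ^ m * icosaT ε hε) := by
  rw [icosaS_pow_mod]
  have : m % 5 < 5 := Nat.mod_lt _ (by norm_num)
  interval_cases m % 5
  · exact Or.inl ⟨2, 0, by simp [icosaT_mul_T]⟩
  · exact Or.inr ⟨1, 4, 1, by rw [icosaT_S_pow_1_T, pow_one icosaU]⟩
  · exact Or.inr ⟨0, 3, 3, by rw [icosaT_S_pow_2_T, pow_zero, one_mul]⟩
  · exact Or.inr ⟨2, 2, 2, icosaT_S_pow_3_T hε⟩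
  · exact Or.inr ⟨3, 1, 4, icosaT_S_pow_4_T hε⟩

theorem IsIcosaWord.T_mul {g : SU2} (hg : IsIcosaWord hε g) :
    IsIcosaWord hε (icosaT ε hε * g) := by
  rcases hg with ⟨j, m, rfl⟩ | ⟨j, m, n, rfl⟩
  · exact Or.inr ⟨3 * j, 0, m, by rw [← mul_assoc, icosaT_mul_U_pow, pow_zero, mul_one]⟩
  · have := ((isIcosaWord_T_S_pow_T hε m).U_pow_mul (3 * j)).mul_S_pow n
    simp only [← mul_assoc, icosaT_mul_U_pow] at this ⊢
    exact this

variable (hε) in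
theorem icosaT_pow_four : icosaT ε hε ^ 4 = 1 := by
  rw [show 4 = 2 * 2 from rfl, pow_mul, pow_two (icosaT ε hε), icosaT_mul_T, ← pow_mul,
    icosaU_pow_four]

/-- For `a` of finite order, `a⁻¹` is a power of `a`, so closure under `a` gives closure under
`a⁻¹`. -/
theorem inv_mul_induction {G : Type*} [Group G] {p : G → Prop} {a : G} {n : ℕ}
    (ha : a ^ (n + 1) = 1) (h : ∀ g, p g → p (a * g)) {g : G} (hg : p g) : p (a⁻¹ * g) := by
  rw [inv_eq_of_mul_eq_one_left (a := a ^ n) (by rwa [← pow_succ])]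
  clear ha
  induction n with
  | zero => simpa
  | succ n ih =>
    rw [pow_succ', mul_assoc]
    exact h _ ih

theorem isIcosaWord_of_mem {g : SU2} (hg : g ∈ icosa ε hε) : IsIcosaWord hε g := by
  have hS : ∀ g, IsIcosaWord hε g → IsIcosaWord hε (icosaS ε hε * g) := fun _ h => h.S_mul
  have hT : ∀ g, IsIcosaWord hε g → IsIcosaWord hε (icosaT ε hε * g) := fun _ h => h.T_mul
  have hU : ∀ g, IsIcosaWord hε g → IsIcosaWord hε (icosaU * g) := fun _ h => by
    simpa using h.U_pow_mul 1
  induction hg using Subgroup.closure_induction_left with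
  | one => exact Or.inl ⟨0, 0, by simp⟩
  | mul_left x hx y _ ih =>
    rcases hx with rfl | rfl | rfl
    exacts [hS _ ih, hT _ ih, hU _ ih]
  | inv_mul_cancel x hx y _ ih =>
    rcases hx with rfl | rfl | rfl
    exacts [inv_mul_induction (icosaS_pow_five hε) hS ih,
      inv_mul_induction (icosaT_pow_four hε) hT ih, inv_mul_induction icosaU_pow_four hU ih]

variable (hε)

theorem icosaS_mem : icosaS ε hε ∈ icosa ε hε := Subgroup.subset_closure (by simp)

theorem icosaT_mem : icosaT ε hε ∈ icosa ε hε := Subgroup.subset_closure (by simp)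

theorem icosaU_mem : icosaU ∈ icosa ε hε := Subgroup.subset_closure (by simp)

/-! ### The orbit and the stabilizer of `x₀` -/

theorem smul_single_zero (g : SU2) :
    g • (EuclideanSpace.single 0 1 : C2) =
      !₂[(g : Matrix (Fin 2) (Fin 2) ℂ) 0 0, (g : Matrix (Fin 2) (Fin 2) ℂ) 1 0] := by
  ext i
  fin_cases i <;> simp [smul_def]

theorem cross_eq_of_mk_eq {v w : C2} (hv : v ≠ 0) (hw : w ≠ 0)
    (h : Projectivization.mk ℂ v hv = Projectivization.mk ℂ w hw) : v 0 * w 1 = v 1 * w 0 := by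
  obtain ⟨a, rfl⟩ := (Projectivization.mk_eq_mk_iff' _ _ _ _ _).mp h
  simp only [PiLp.smul_apply, smul_eq_mul]
  ring

/-- The line `g • x0` is spanned by the first column of `g`; equal lines have proportional columns.
-/
theorem cross_eq_of_smul_x0_eq {g h : SU2} (hgh : g • x0 = h • x0) :
    (g : Matrix (Fin 2) (Fin 2) ℂ) 0 0 * (h : Matrix (Fin 2) (Fin 2) ℂ) 1 0 =
      (g : Matrix (Fin 2) (Fin 2) ℂ) 1 0 * (h : Matrix (Fin 2) (Fin 2) ℂ) 0 0 := by
  rw [x0, smul_mk, smul_mk] at hgh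
  have := cross_eq_of_mk_eq _ _ hgh
  rw [smul_single_zero, smul_single_zero] at this
  simpa using this

theorem smul_x0_eq_of_entry_eq_zero {g : SU2}
    (h : (g : Matrix (Fin 2) (Fin 2) ℂ) 1 0 = 0) : g • x0 = x0 := by
  rw [x0, smul_mk]
  refine (Projectivization.mk_eq_mk_iff' _ _ _ _ _).mpr
    ⟨(g : Matrix (Fin 2) (Fin 2) ℂ) 0 0, ?_⟩
  rw [smul_single_zero, h]
  ext i
  fin_cases i <;> simp

theorem entry_eq_zero_of_smul_x0_eq {g : SU2} (h : g • x0 = x0) :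
    (g : Matrix (Fin 2) (Fin 2) ℂ) 1 0 = 0 := by
  have := cross_eq_of_smul_x0_eq (g := g) (h := 1) (h.trans (one_smul _ _).symm)
  simpa using this.symm

theorem icosaS_pow_smul_x0 (m : ℕ) : icosaS ε hε ^ m • x0 = x0 :=
  smul_x0_eq_of_entry_eq_zero (by rw [coe_icosaS_pow]; simp)

theorem icosaU_pow_two_smul (l : CP1) : icosaU ^ 2 • l = l := by
  induction l using Projectivization.ind with
  | h w hw =>
    rw [smul_mk]
    refine (Projectivization.mk_eq_mk_iff' _ _ _ _ _).mpr ⟨-1, ?_⟩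
    rw [smul_def, coe_icosaU_pow_two]
    ext i
    fin_cases i <;> simp [Matrix.vecHead, Matrix.vecTail]

/-- Elements of the binary icosahedral group that move `x₀` to the twelve points of its orbit. -/
def icosaRep (p : Fin 2 × Option (Fin 5)) : SU2 :=
  icosaU ^ (p.1 : ℕ) * p.2.elim 1 fun m => icosaS ε hε ^ (m : ℕ) * icosaT ε hε

theorem icosaRep_mem (p : Fin 2 × Option (Fin 5)) : icosaRep hε p ∈ icosa ε hε := by
  refine mul_mem (pow_mem (icosaU_mem hε) _) ?_
  rcases p with ⟨_, _ | m⟩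
  · exact one_mem _
  · exact mul_mem (pow_mem (icosaS_mem hε) _) (icosaT_mem hε)

theorem icosaU_pow_smul (j : ℕ) (l : CP1) : icosaU ^ j • l = icosaU ^ (j % 2) • l := by
  have h (i : ℕ) : (icosaU ^ 2) ^ i • l = l := by
    induction i with
    | zero => simp
    | succ i ih => rw [pow_succ, mul_smul, icosaU_pow_two_smul, ih]
  conv_lhs => rw [← Nat.mod_add_div j 2, pow_add, pow_mul, mul_smul, h]

/-- A trailing power of `S` fixes `x0`, and `U ^ 2 = -1` fixes every line, so only `j` mod 2 and `m`
mod 5 matter. -/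
theorem IsIcosaWord.exists_smul_x0_eq {g : SU2} (hg : IsIcosaWord hε g) :
    ∃ p, g • x0 = icosaRep hε p • x0 := by
  have h2 (j : ℕ) : j % 2 < 2 := Nat.mod_lt _ (by norm_num)
  rcases hg with ⟨j, m, rfl⟩ | ⟨j, m, n, rfl⟩
  · refine ⟨(⟨j % 2, h2 j⟩, none), ?_⟩
    rw [mul_smul, icosaS_pow_smul_x0, icosaU_pow_smul]
    simp [icosaRep]
  · refine ⟨(⟨j % 2, h2 j⟩, some ⟨m % 5, Nat.mod_lt _ (by norm_num)⟩), ?_⟩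
    rw [mul_smul, icosaS_pow_smul_x0, mul_assoc, mul_smul, icosaU_pow_smul, icosaS_pow_mod]
    simp [icosaRep, mul_smul]

/-! ### Distinctness of the twelve orbit points -/

theorem golden_sq {ε : ℂ} (hε : IsPrimitiveRoot ε 5) : (ε + ε ^ 4) ^ 2 = 1 - (ε + ε ^ 4) := by
  linear_combination (2 + ε ^ 3) * hε.pow_eq_one + sum_of_primitive hε

theorem golden_ne_zero {ε : ℂ} (hε : IsPrimitiveRoot ε 5) : ε + ε ^ 4 ≠ 0 := by
  intro h
  have := golden_sq hε
  rw [h] at this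
  norm_num at this

/-- From `a² = 1 - a`, powers of `a` reduce to linear expressions with Fibonacci coefficients; `a¹⁰
= -1` would force `a = 7/11`, which violates the quadratic equation. -/
theorem golden_pow_ten_ne {ε : ℂ} (hε : IsPrimitiveRoot ε 5) : (ε + ε ^ 4) ^ 10 ≠ -1 := by
  intro h
  have h2 := golden_sq hε
  generalize ε + ε ^ 4 = a at h h2
  have h1 : a ^ 10 = 34 - 55 * a := by
    have h4 : a ^ 4 = 2 - 3 * a := by linear_combination (a ^ 2 - a + 2) * h2
    have h8 : a ^ 8 = 13 - 21 * a := by linear_combination (a ^ 4 + 2 - 3 * a) * h4 + 9 * h2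
    linear_combination a ^ 2 * h8 + (34 - 21 * a) * h2
  have h3 : a = 7 / 11 := by linear_combination (h1 - h) / 55
  rw [h3] at h2
  norm_num at h2

theorem coe_icosaS_pow_mul_T (m : ℕ) :
    ((icosaS ε hε ^ m * icosaT ε hε : SU2) : Matrix (Fin 2) (Fin 2) ℂ) =
      (1 / (ε ^ 2 - ε ^ 3)) • !![ε ^ (3 * m) * (ε + ε ^ 4), ε ^ (3 * m);
        ε ^ (2 * m), -(ε ^ (2 * m) * (ε + ε ^ 4))] := by
  rw [Submonoid.coe_mul, coe_icosaS_pow, coe_icosaT, Matrix.mul_fin_two, Matrix.smul_of,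
    Matrix.smul_cons, Matrix.smul_cons]
  simp only [Matrix.smul_cons, smul_eq_mul, Matrix.smul_empty]
  refine matrix_fin_two_congr ?_ ?_ ?_ ?_ <;> ring

theorem coe_icosaU_mul (g : SU2) :
    ((icosaU * g : SU2) : Matrix (Fin 2) (Fin 2) ℂ) =
      !![(g : Matrix (Fin 2) (Fin 2) ℂ) 1 0, (g : Matrix (Fin 2) (Fin 2) ℂ) 1 1;
        -(g : Matrix (Fin 2) (Fin 2) ℂ) 0 0, -(g : Matrix (Fin 2) (Fin 2) ℂ) 0 1] := by
  rw [Submonoid.coe_mul, coe_icosaU, Matrix.eta_fin_two (g : Matrix (Fin 2) (Fin 2) ℂ),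
    Matrix.mul_fin_two]
  simp

theorem icosaS_pow_mul_T_smul_x0_ne (m : ℕ) : (icosaS ε hε ^ m * icosaT ε hε) • x0 ≠ x0 := by
  intro h
  have h := entry_eq_zero_of_smul_x0_eq h
  rw [coe_icosaS_pow_mul_T] at h
  simp [sub_ne_zero_of_primitive hε, hε.ne_zero (by norm_num)] at h

theorem icosaS_pow_mul_T_smul_x0_inj {m n : Fin 5}
    (h : (icosaS ε hε ^ (m : ℕ) * icosaT ε hε) • x0 =
      (icosaS ε hε ^ (n : ℕ) * icosaT ε hε) • x0) : m = n := by
  have h0 : ε ≠ 0 := hε.ne_zero (by norm_num)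
  have h := cross_eq_of_smul_x0_eq h
  rw [coe_icosaS_pow_mul_T, coe_icosaS_pow_mul_T] at h
  have hc : 1 / (ε ^ 2 - ε ^ 3) ≠ 0 := one_div_ne_zero (sub_ne_zero_of_primitive hε)
  generalize 1 / (ε ^ 2 - ε ^ 3) = c at hc h
  have ha := golden_ne_zero hε
  generalize ε + ε ^ 4 = a at ha h
  simp only [Matrix.smul_apply, Matrix.of_apply, Matrix.cons_val', Matrix.cons_val_zero,
    Matrix.cons_val_one, Matrix.cons_val_fin_one, smul_eq_mul] at h
  have h2 : (c ^ 2 * a * ε ^ (2 * (m : ℕ)) * ε ^ (2 * (n : ℕ))) * ε ^ (m : ℕ) =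
      (c ^ 2 * a * ε ^ (2 * (m : ℕ)) * ε ^ (2 * (n : ℕ))) * ε ^ (n : ℕ) := by
    linear_combination h
  exact Fin.ext (hε.pow_inj m.2 n.2 (mul_left_cancel₀ (by simp [*]) h2))

theorem icosaU_mul_smul_x0_ne (o o' : Option (Fin 5)) :
    icosaRep hε (0, o) • x0 ≠ icosaRep hε (1, o') • x0 := by
  intro h
  have h5 : ε ^ 5 = 1 := hε.pow_eq_one
  have h0 : ε ≠ 0 := hε.ne_zero (by norm_num)
  have h := cross_eq_of_smul_x0_eq h
  have hc : 1 / (ε ^ 2 - ε ^ 3) ≠ 0 := one_div_ne_zero (sub_ne_zero_of_primitive hε)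
  have ha := golden_ne_zero hε
  have ha' := golden_pow_ten_ne hε
  simp only [icosaRep, Fin.val_zero, Fin.val_one, pow_zero, pow_one, one_mul, coe_icosaU_mul] at h
  rcases o with _ | m <;> rcases o' with _ | n <;>
    simp only [Option.elim_none, Option.elim_some, coe_icosaS_pow_mul_T] at h <;>
    generalize 1 / (ε ^ 2 - ε ^ 3) = c at hc h <;>
    generalize ε + ε ^ 4 = a at ha ha' h <;>
    simp [hc, ha, h0] at h
  -- Only the case of two words containing `T` is left. Equality of the lines says `1 = -a²
  -- ε^(m+n)`; the fifth power removes the root of unity and gives `a¹⁰ = -1`.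
  have h2 : (c ^ 2 * ε ^ (2 * (m : ℕ)) * ε ^ (2 * (n : ℕ))) * 1 =
      (c ^ 2 * ε ^ (2 * (m : ℕ)) * ε ^ (2 * (n : ℕ))) * (-a ^ 2 * ε ^ (m + n : ℕ)) := by
    linear_combination -h
  have h3 := mul_left_cancel₀ (by simp [*]) h2
  apply ha'
  have h4 : (ε ^ (m + n : ℕ)) ^ 5 = 1 := by rw [← pow_mul, mul_comm, pow_mul, h5, one_pow]
  have h6 : (1 : ℂ) = (-a ^ 2 * ε ^ (m + n : ℕ)) ^ 5 := by rw [← h3, one_pow]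
  linear_combination h6 - a ^ 10 * h4

theorem icosaRep_smul_x0_injective : Function.Injective fun p => icosaRep hε p • x0 := by
  have h1 (o o' : Option (Fin 5)) (h : icosaRep hε (0, o) • x0 = icosaRep hε (0, o') • x0) :
      o = o' := by
    simp only [icosaRep, Fin.val_zero, pow_zero, one_mul] at h
    rcases o with _ | m <;> rcases o' with _ | n
    · rfl
    · exact absurd (h.symm.trans (one_smul _ _)) (icosaS_pow_mul_T_smul_x0_ne hε n)
    · exact absurd (h.trans (one_smul _ _)) (icosaS_pow_mul_T_smul_x0_ne hε m)
    · rw [icosaS_pow_mul_T_smul_x0_inj hε h]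
  have h2 (o : Option (Fin 5)) : icosaRep hε (1, o) • x0 = icosaU • icosaRep hε (0, o) • x0 := by
    simp [icosaRep, mul_smul]
  rintro ⟨b, o⟩ ⟨b', o'⟩ h
  fin_cases b <;> fin_cases b'
  · exact Prod.ext rfl (h1 o o' h)
  · exact absurd h (icosaU_mul_smul_x0_ne hε o o')
  · exact absurd h.symm (icosaU_mul_smul_x0_ne hε o' o)
  · have h : icosaRep hε (1, o) • x0 = icosaRep hε (1, o') • x0 := h
    rw [h2, h2] at h
    exact Prod.ext rfl (h1 o o' (MulAction.injective _ h))

theorem orbit_eq_range : MulAction.orbit (icosa ε hε) x0 =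
    Set.range fun p => icosaRep hε p • x0 := by
  ext y
  constructor
  · rintro ⟨g, rfl⟩
    obtain ⟨p, hp⟩ := (isIcosaWord_of_mem g.2).exists_smul_x0_eq
    exact ⟨p, hp.symm⟩
  · rintro ⟨p, rfl⟩
    exact ⟨⟨_, icosaRep_mem hε p⟩, rfl⟩

theorem card_orbit : Nat.card (MulAction.orbit (icosa ε hε) x0) = 12 := by
  rw [orbit_eq_range, Nat.card_range_of_injective (icosaRep_smul_x0_injective hε)]
  simp

/-! ### The stabilizer and the order of the group -/

theorem orderOf_icosaS : orderOf (icosaS ε hε) = 5 := by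
  have : Fact (Nat.Prime 5) := ⟨by norm_num⟩
  refine orderOf_eq_prime (icosaS_pow_five hε) fun h => ?_
  have h1 : ((icosaS ε hε : SU2) : Matrix (Fin 2) (Fin 2) ℂ) 0 0 = 1 := by rw [h]; rfl
  rw [coe_icosaS] at h1
  exact hε.pow_ne_one_of_pos_of_lt (by norm_num) (by norm_num : 3 < 5) h1

theorem orderOf_icosaU_pow_two : orderOf (icosaU ^ 2) = 2 := by
  refine orderOf_eq_prime (by rw [← pow_mul, icosaU_pow_four]) fun h => ?_
  have h1 : ((icosaU ^ 2 : SU2) : Matrix (Fin 2) (Fin 2) ℂ) 0 0 = 1 := by rw [h]; rfl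
  rw [coe_icosaU_pow_two] at h1
  norm_num at h1

theorem commute_icosaU_pow_two_S : Commute (icosaU ^ 2) (icosaS ε hε) := by
  have h := icosaS_pow_mul_U_pow hε 1 2
  rw [icosaS_pow_mod, icosaS_pow_mod hε (1 * 4 ^ 2)] at h
  norm_num at h
  exact h.symm

/-- The generator is `U² S = -S`. In normal form, a word fixing `x0` contains no `T` and an even
power of `U`. -/
theorem mem_stabilizer_iff (g : icosa ε hε) :
    g ∈ MulAction.stabilizer (icosa ε hε) x0 ↔
      (g : SU2) ∈ Subgroup.zpowers (icosaU ^ 2 * icosaS ε hε) := by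
  have hcomm := commute_icosaU_pow_two_S hε
  constructor
  · intro hg
    have hg : (g : SU2) • x0 = x0 := hg
    obtain ⟨g, hmem⟩ := g
    simp only at hg ⊢
    have h0 : icosaRep hε (0, none) • x0 = x0 := by simp [icosaRep]
    rcases isIcosaWord_of_mem hmem with ⟨j, m, rfl⟩ | ⟨j, m, n, rfl⟩
    · have hj : j % 2 = 0 := by
        rw [mul_smul, icosaS_pow_smul_x0, icosaU_pow_smul] at hg
        by_contra h
        rw [Nat.mod_two_ne_zero.mp h] at hg
        exact icosaU_mul_smul_x0_ne hε none none (h0.trans (by simpa [icosaRep] using hg.symm))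
      obtain ⟨i, rfl⟩ := Nat.dvd_of_mod_eq_zero hj
      -- By the Chinese remainder theorem: this exponent is `i` mod 2, for `U ^ 2`, and `m` mod 5,
      -- for `S`.
      refine ⟨(5 * i + 6 * m : ℕ), ?_⟩
      simp only [zpow_natCast]
      rw [hcomm.mul_pow, ← pow_mul]
      congr 1
      · rw [icosaU_pow_mod, icosaU_pow_mod (2 * i)]
        congr 1
        omega
      · rw [icosaS_pow_mod, icosaS_pow_mod hε m]
        congr 1
        omega
    · exfalso
      rw [mul_smul, icosaS_pow_smul_x0, mul_assoc, mul_smul, icosaU_pow_smul, icosaS_pow_mod] at hg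
      have := icosaRep_smul_x0_injective hε (a₁ := (⟨j % 2, Nat.mod_lt _ (by norm_num)⟩,
        some ⟨m % 5, Nat.mod_lt _ (by norm_num)⟩)) (a₂ := (0, none))
        (by simpa [icosaRep, mul_smul] using hg)
      simp at this
  · rintro ⟨k, hk⟩
    have h : icosaU ^ 2 * icosaS ε hε ∈ MulAction.stabilizer SU2 x0 := by
      rw [MulAction.mem_stabilizer_iff, mul_smul, icosaU_pow_two_smul]
      simpa using icosaS_pow_smul_x0 hε 1
    have h2 := zpow_mem h k
    simp only at hk
    rw [hk] at h2
    exact h2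

theorem card_stabilizer : Nat.card (MulAction.stabilizer (icosa ε hε) x0) = 10 := by
  have h : (Subgroup.zpowers (icosaU ^ 2 * icosaS ε hε)).subgroupOf (icosa ε hε) =
      MulAction.stabilizer (icosa ε hε) x0 := by
    ext g
    rw [Subgroup.mem_subgroupOf, mem_stabilizer_iff]
  have hle : Subgroup.zpowers (icosaU ^ 2 * icosaS ε hε) ≤ icosa ε hε :=
    Subgroup.zpowers_le.mpr (mul_mem (pow_mem (icosaU_mem hε) 2) (icosaS_mem hε))
  rw [← h, Nat.card_congr (Subgroup.subgroupOfEquivOfLe hle).toEquiv, Nat.card_zpowers,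
    (commute_icosaU_pow_two_S hε).orderOf_mul_eq_mul_orderOf_of_coprime, orderOf_icosaS,
    orderOf_icosaU_pow_two]
  rw [orderOf_icosaS, orderOf_icosaU_pow_two]
  norm_num

theorem card_quotient_stabilizer :
    Nat.card (icosa ε hε ⧸ MulAction.stabilizer (icosa ε hε) x0) = 12 := by
  rw [← card_orbit hε]
  exact Nat.card_congr (MulAction.orbitEquivQuotientStabilizer _ _).symm

theorem card_icosa : Nat.card (icosa ε hε) = 120 := by
  rw [Subgroup.card_eq_card_quotient_mul_card_subgroup (MulAction.stabilizer (icosa ε hε) x0),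
    card_quotient_stabilizer, card_stabilizer]

end Group

/-! ### Intertwining maps from symmetric powers to sections -/

open MvPolynomial in
/-- The monomial `X₀^i X₁^j`. -/
def mon (i j : ℕ) : MvPolynomial (Fin 2) ℂ := X 0 ^ i * X 1 ^ j

theorem mon_isHomogeneous (i j : ℕ) : (mon i j).IsHomogeneous (i + j) :=
  (MvPolynomial.isHomogeneous_X_pow _ _).mul (MvPolynomial.isHomogeneous_X_pow _ _)

theorem eq_zero_of_forall_mon {M : Type*} [AddCommGroup M] [Module ℂ M] {n : ℕ}
    (f : MvPolynomial (Fin 2) ℂ →ₗ[ℂ] M) (h : ∀ i j, i + j = n → f (mon i j) = 0)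
    {p : MvPolynomial (Fin 2) ℂ} (hp : p.IsHomogeneous n) : f p = 0 := by
  rw [p.as_sum, map_sum]
  refine Finset.sum_eq_zero fun d hd => ?_
  have hd' : d 0 + d 1 = n := by
    have := hp (MvPolynomial.mem_support_iff.mp hd)
    rw [← this, Finsupp.weight_apply, Finsupp.sum_fintype _ _ (by simp), Fin.sum_univ_two]
    simp
  have hm : MvPolynomial.monomial d (MvPolynomial.coeff d p) =
      MvPolynomial.coeff d p • mon (d 0) (d 1) := by
    rw [MvPolynomial.monomial_eq, Finsupp.prod_fintype _ _ (by simp), Fin.prod_univ_two,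
      MvPolynomial.smul_eq_C_mul, mon]
  rw [hm, map_smul, h _ _ hd', smul_zero]

open MvPolynomial in
theorem symAlgAct_mon (g : SU2) (i j : ℕ) :
    symAlgAct g (mon i j) =
      (C ((g : Matrix (Fin 2) (Fin 2) ℂ) 0 0) * X 0 +
        C ((g : Matrix (Fin 2) (Fin 2) ℂ) 1 0) * X 1) ^ i *
      (C ((g : Matrix (Fin 2) (Fin 2) ℂ) 0 1) * X 0 +
        C ((g : Matrix (Fin 2) (Fin 2) ℂ) 1 1) * X 1) ^ j := by
  simp [symAlgAct, mon, Fin.sum_univ_two]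

theorem symAlgAct_mon_of_diagonal (g : SU2)
    (h01 : (g : Matrix (Fin 2) (Fin 2) ℂ) 0 1 = 0) (h10 : (g : Matrix (Fin 2) (Fin 2) ℂ) 1 0 = 0)
    (i j : ℕ) :
    symAlgAct g (mon i j) = ((g : Matrix (Fin 2) (Fin 2) ℂ) 0 0 ^ i *
      (g : Matrix (Fin 2) (Fin 2) ℂ) 1 1 ^ j) • mon i j := by
  rw [symAlgAct_mon, h01, h10, MvPolynomial.smul_eq_C_mul, mon]
  simp only [map_zero, zero_mul, zero_add, add_zero, map_mul, map_pow]
  ring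

theorem symAlgAct_isHomogeneous (g : SU2) {n : ℕ} {p : MvPolynomial (Fin 2) ℂ}
    (hp : p.IsHomogeneous n) : (symAlgAct g p).IsHomogeneous n :=
  symAlgAct_mem g n p hp

/-- `Φ` intertwines the actions of `SU(2)` on `Sⁿ(ℂ²)` and on `Γ`. -/
def IsIntertwiner (n : ℕ) (Φ : MvPolynomial (Fin 2) ℂ →ₗ[ℂ] Sec) : Prop :=
  ∀ (g : SU2) (p : MvPolynomial (Fin 2) ℂ), p.IsHomogeneous n →
    Φ (symAlgAct g p) = secAct g (Φ p)

theorem IsIntertwiner.smul {n : ℕ} {Φ : MvPolynomial (Fin 2) ℂ →ₗ[ℂ] Sec}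
    (h : IsIntertwiner n Φ) (c : ℂ) : IsIntertwiner n (c • Φ) := fun g p hp => by
  rw [LinearMap.smul_apply, LinearMap.smul_apply, h g p hp, map_smul]

theorem IsIntertwiner.sub {n : ℕ} {Φ Ψ : MvPolynomial (Fin 2) ℂ →ₗ[ℂ] Sec}
    (h : IsIntertwiner n Φ) (h' : IsIntertwiner n Ψ) : IsIntertwiner n (Φ - Ψ) := fun g p hp => by
  rw [LinearMap.sub_apply, LinearMap.sub_apply, h g p hp, h' g p hp, map_sub]

/-- Precomposing with the projection to degree `n` extends the inverse isomorphism to all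
polynomials, so later arguments avoid subtypes. -/
theorem exists_isIntertwiner {n : ℕ} (W : Subrepresentation secRep)
    (e : W.toRepresentation.Equiv (symRep n)) :
    ∃ Φ, IsIntertwiner n Φ ∧ ∀ s ∈ W.toSubmodule, ∃ p, p.IsHomogeneous n ∧ Φ p = s := by
  let P : MvPolynomial (Fin 2) ℂ →ₗ[ℂ] MvPolynomial.homogeneousSubmodule (Fin 2) ℂ n :=
    (MvPolynomial.homogeneousComponent n).codRestrict _ fun p =>
      MvPolynomial.homogeneousComponent_mem n p
  have hP : ∀ p (hp : p.IsHomogeneous n), P p = ⟨p, hp⟩ := fun p hp => Subtype.ext <| by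
    change MvPolynomial.homogeneousComponent n p = p
    rw [MvPolynomial.homogeneousComponent_of_mem hp, if_pos rfl]
  refine ⟨W.toSubmodule.subtype ∘ₗ e.symm.toIntertwiningMap.toLinearMap ∘ₗ P, ?_, ?_⟩
  · intro g p hp
    have h1 : P (symAlgAct g p) = symRep n g (P p) := by
      rw [hP p hp, hP _ (symAlgAct_isHomogeneous g hp)]
      rfl
    have h2 := LinearMap.congr_fun (e.symm.toIntertwiningMap.isIntertwining' g) (P p)
    simp only [LinearMap.comp_apply] at h2 ⊢
    rw [h1, h2]
    rfl
  · intro s hs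
    refine ⟨(e ⟨s, hs⟩ : MvPolynomial (Fin 2) ℂ), (e ⟨s, hs⟩).2, ?_⟩
    have h3 : P (e ⟨s, hs⟩ : MvPolynomial (Fin 2) ℂ) = e ⟨s, hs⟩ := hP _ (e ⟨s, hs⟩).2
    change ((e.symm (P _) : W.toSubmodule) : Sec) = s
    rw [h3]
    simp

/-- The element `diag(u, ū)` of `SU(2)`. -/
def torus (u : ℂ) (hu : u * starRingEnd ℂ u = 1) : SU2 :=
  ⟨!![u, 0; 0, starRingEnd ℂ u], by
    rw [Matrix.mem_specialUnitaryGroup_iff, Matrix.mem_unitaryGroup_iff]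
    constructor
    · ext i j
      fin_cases i <;> fin_cases j <;>
        simp [Matrix.mul_apply, Fin.sum_univ_two, Matrix.star_apply, hu, mul_comm _ u]
    · simp [Matrix.det_fin_two_of, hu]⟩

theorem mem_fiber_x0 {v : C2} (hv : v ∈ fiber x0) : v 1 = 0 := by
  rw [x0, fiber_mk, Submodule.mem_span_singleton] at hv
  obtain ⟨c, rfl⟩ := hv
  simp

theorem eval_x0_eq {s t : Sec} (h : (eval x0 s : C2) 0 = (eval x0 t : C2) 0) :
    eval x0 s = eval x0 t := by
  apply Subtype.ext
  ext i
  fin_cases i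
  · exact h
  · exact (mem_fiber_x0 (eval x0 s).2).trans (mem_fiber_x0 (eval x0 t).2).symm

/-- The torus fixes `x0` and acts on its fibre with weight 1, while `mon i j` has weight `i - j`. -/
theorem IsIntertwiner.eval_x0_mon {i j : ℕ} {Φ : MvPolynomial (Fin 2) ℂ →ₗ[ℂ] Sec}
    (h : IsIntertwiner (i + j) Φ) (hij : i ≠ j + 1) : eval x0 (Φ (mon i j)) = 0 := by
  -- The order exceeds both `i` and `j + 1`, so `u ^ i = u ^ (j + 1)` forces equal exponents.
  have hζ := Complex.isPrimitiveRoot_exp (i + j + 2) (by omega)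
  set u := Complex.exp (2 * Real.pi * Complex.I / (i + j + 2 : ℕ))
  have hu : u * starRingEnd ℂ u = 1 := by
    rw [Complex.mul_conj, Complex.normSq_eq_norm_sq, hζ.norm'_eq_one (by omega)]
    norm_num
  have hu0 : u ≠ 0 := left_ne_zero_of_mul_eq_one hu
  have h1 := h (torus u hu) _ (mon_isHomogeneous i j)
  rw [symAlgAct_mon_of_diagonal _ rfl rfl, map_smul] at h1
  have h2 : torus u hu • x0 = x0 := smul_x0_eq_of_entry_eq_zero rfl
  have h3 := congrArg (fun s => (eval x0 s : C2) 0) h1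
  have h4 : (eval x0 (secAct (torus u hu) (Φ (mon i j))) : C2) =
      torus u hu • (eval x0 (Φ (mon i j)) : C2) := by
    rw [← eval_secAct_smul]
    exact eval_congr h2.symm _
  have h5 : (torus u hu • (eval x0 (Φ (mon i j)) : C2)) 0 =
      u * (eval x0 (Φ (mon i j)) : C2) 0 := by
    rw [smul_def, torus]
    simp [Matrix.vecHead]
  simp only [h4, h5, map_smul, Submodule.coe_smul, PiLp.smul_apply, smul_eq_mul] at h3
  change (u ^ i * starRingEnd ℂ u ^ j) * _ = _ at h3
  rw [← map_zero (eval x0)]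
  refine eval_x0_eq ?_
  by_contra hne
  rw [map_zero] at hne
  have h6 := mul_right_cancel₀ hne h3
  have h7 : u ^ i = u ^ (j + 1) := by
    calc u ^ i = u ^ i * (u * starRingEnd ℂ u) ^ j := by rw [hu, one_pow, mul_one]
      _ = u ^ j * (u ^ i * starRingEnd ℂ u ^ j) := by ring
      _ = u ^ (j + 1) := by rw [h6]; ring
  exact hij (hζ.pow_inj (by omega) (by omega) h7)

theorem exists_smul_x0_eq (l : CP1) : ∃ g : SU2, g • x0 = l := by
  induction l using Projectivization.ind with
  | h w hw =>
    have hn : (‖w‖ : ℂ) ≠ 0 := by simpa using hw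
    have hn2 : w 0 * starRingEnd ℂ (w 0) + w 1 * starRingEnd ℂ (w 1) = (‖w‖ : ℂ) ^ 2 := by
      rw [Complex.mul_conj, Complex.mul_conj, Complex.normSq_eq_norm_sq,
        Complex.normSq_eq_norm_sq, ← Complex.ofReal_pow ‖w‖, EuclideanSpace.norm_sq_eq,
        Fin.sum_univ_two]
      push_cast
      rfl
    -- The normalized vector `w / ‖w‖` as first column, completed to a special unitary matrix.
    refine ⟨⟨!![w 0 / ‖w‖, -starRingEnd ℂ (w 1) / ‖w‖; w 1 / ‖w‖, starRingEnd ℂ (w 0) / ‖w‖],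
      ?_⟩, ?_⟩
    · rw [Matrix.mem_specialUnitaryGroup_iff, Matrix.mem_unitaryGroup_iff]
      constructor
      · ext i j
        fin_cases i <;> fin_cases j <;>
          simp [Matrix.mul_apply, Fin.sum_univ_two, Matrix.star_apply] <;> field_simp
        · linear_combination hn2
        · ring
        · ring
        · linear_combination hn2
      · rw [Matrix.det_fin_two_of]
        field_simp
        linear_combination hn2
    · rw [x0, smul_mk]
      refine (Projectivization.mk_eq_mk_iff' _ _ _ _ _).mpr ⟨1 / ‖w‖, ?_⟩
      rw [smul_single_zero]
      ext i
      fin_cases i <;> simp [div_eq_inv_mul]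

/-- `SU(2)` is transitive on lines, and the value of `Φ p` at `g • x0` is `g` applied to the value
of `Φ (g⁻¹ p)` at `x0`. -/
theorem IsIntertwiner.eq_zero {n : ℕ} {Φ : MvPolynomial (Fin 2) ℂ →ₗ[ℂ] Sec}
    (h : IsIntertwiner n Φ) (h0 : ∀ p, p.IsHomogeneous n → eval x0 (Φ p) = 0)
    {p : MvPolynomial (Fin 2) ℂ} (hp : p.IsHomogeneous n) : Φ p = 0 := by
  ext l : 1
  obtain ⟨g, rfl⟩ := exists_smul_x0_eq l
  have h1 : Φ p = secAct g (Φ (symAlgAct g⁻¹ p)) := by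
    rw [← h g _ (symAlgAct_isHomogeneous g⁻¹ hp), ← AlgHom.comp_apply, ← symAlgAct_mul, mul_inv_cancel,
      symAlgAct_one]
    rfl
  rw [h1, eval_secAct_smul, h0 _ (symAlgAct_isHomogeneous g⁻¹ hp)]
  exact smul_zero g

/-- Multiplicity at most one: the difference of the two sides is an intertwiner vanishing at `x0` on
every monomial, on `mon (k + 1) k` by the choice of coefficients and on the others by weight. -/
theorem IsIntertwiner.smul_eq {k : ℕ} {Φ Ψ : MvPolynomial (Fin 2) ℂ →ₗ[ℂ] Sec}
    (hΦ : IsIntertwiner (2 * k + 1) Φ) (hΨ : IsIntertwiner (2 * k + 1) Ψ)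
    {p : MvPolynomial (Fin 2) ℂ} (hp : p.IsHomogeneous (2 * k + 1)) :
    (eval x0 (Ψ (mon (k + 1) k)) : C2) 0 • Φ p = (eval x0 (Φ (mon (k + 1) k)) : C2) 0 • Ψ p := by
  have h := (hΦ.smul ((eval x0 (Ψ (mon (k + 1) k)) : C2) 0)).sub
    (hΨ.smul ((eval x0 (Φ (mon (k + 1) k)) : C2) 0))
  have hm : (((eval x0 (Ψ (mon (k + 1) k)) : C2) 0) • Φ -
      ((eval x0 (Φ (mon (k + 1) k)) : C2) 0) • Ψ) p = 0 := by
    refine h.eq_zero (fun q hq => ?_) hp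
    change (eval x0 ∘ₗ (((eval x0 (Ψ (mon (k + 1) k)) : C2) 0) • Φ -
      ((eval x0 (Φ (mon (k + 1) k)) : C2) 0) • Ψ)) q = 0
    refine eq_zero_of_forall_mon _ (fun i j hij => ?_) hq
    by_cases hij' : i = j + 1
    · obtain rfl : j = k := by omega
      subst hij'
      rw [LinearMap.comp_apply, ← map_zero (eval x0)]
      refine eval_x0_eq ?_
      simp
      ring
    · rw [← hij] at h
      exact h.eval_x0_mon hij'
  exact sub_eq_zero.mp hm

/-! ### The isotypic components as images of intertwiners -/

theorem Gam_le {k : ℕ} {N : Submodule ℂ Sec}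
    (h : ∀ Φ, IsIntertwiner (2 * k - 1) Φ → ∀ p, p.IsHomogeneous (2 * k - 1) → Φ p ∈ N) :
    Gam k ≤ N := by
  refine iSup_le ?_
  rintro ⟨W, ⟨e⟩⟩ s hs
  obtain ⟨Φ, hΦ, hW⟩ := exists_isIntertwiner W e
  obtain ⟨p, hp, rfl⟩ := hW s hs
  exact h Φ hΦ p hp

theorem Gam_succ_le_map {k : ℕ} {Ψ : MvPolynomial (Fin 2) ℂ →ₗ[ℂ] Sec}
    (hΨ : IsIntertwiner (2 * k + 1) Ψ) (h0 : (eval x0 (Ψ (mon (k + 1) k)) : C2) 0 ≠ 0) :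
    Gam (k + 1) ≤ (MvPolynomial.homogeneousSubmodule (Fin 2) ℂ (2 * k + 1)).map Ψ := by
  refine Gam_le fun Φ hΦ p hp => ?_
  have h := IsIntertwiner.smul_eq (k := k) hΦ hΨ hp
  rw [← inv_smul_smul₀ h0 (Φ p), h, smul_smul]
  exact Submodule.smul_mem _ _ ⟨p, hp, rfl⟩

instance finite_homogeneousSubmodule (n : ℕ) :
    Module.Finite ℂ (MvPolynomial.homogeneousSubmodule (Fin 2) ℂ n) :=
  Module.Finite.iff_fg.mpr (MvPolynomial.homogeneousSubmodule_fg (Fin 2) ℂ n)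

/-- No intertwiner has to be constructed: either one is nonzero at `x0` and its image contains the
component, or all vanish and the component is zero. -/
theorem finiteDimensional_Gam_succ (k : ℕ) : FiniteDimensional ℂ (Gam (k + 1)) := by
  by_cases h : ∃ Ψ, IsIntertwiner (2 * k + 1) Ψ ∧ (eval x0 (Ψ (mon (k + 1) k)) : C2) 0 ≠ 0
  · obtain ⟨Ψ, hΨ, h0⟩ := h
    exact Submodule.finiteDimensional_of_le (Gam_succ_le_map hΨ h0)
  · push Not at h
    have : Gam (k + 1) ≤ ⊥ := Gam_le fun Φ hΦ p hp => by
      rw [Submodule.mem_bot]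
      refine hΦ.eq_zero (fun q hq => ?_) hp
      change (eval x0 ∘ₗ Φ) q = 0
      refine eq_zero_of_forall_mon _ (fun i j hij => ?_) hq
      by_cases hij' : i = j + 1
      · obtain rfl : j = k := by omega
        subst hij'
        rw [LinearMap.comp_apply, ← map_zero (eval x0)]
        refine eval_x0_eq ?_
        rw [h Φ hΦ]
        simp
      · rw [← hij] at hΦ
        exact hΦ.eval_x0_mon hij'
    exact Submodule.finiteDimensional_of_le this

/-- Makes the trace on `H` meaningful: `LinearMap.trace` is zero by default when there is no finite
basis. -/
instance finiteDimensional_Hsp : FiniteDimensional ℂ Hsp := by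
  refine Module.Finite.iff_fg.mpr (Submodule.fg_biSup _ _ fun k hk => ?_)
  obtain ⟨k, rfl⟩ := Nat.exists_eq_succ_of_ne_zero
    (Nat.one_le_iff_ne_zero.mp (Finset.mem_Icc.mp hk).1)
  exact Module.Finite.iff_fg.mp (finiteDimensional_Gam_succ k)

theorem exists_linForm_leftInverse :
    ∃ f : MvPolynomial (Fin 2) ℂ →ₗ[ℂ] C2, ∀ v, f (linForm v : MvPolynomial (Fin 2) ℂ) = v := by
  refine ⟨(WithLp.linearEquiv 2 ℂ (Fin 2 → ℂ)).symm.toLinearMap ∘ₗ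
      LinearMap.pi fun i => MvPolynomial.lcoeff ℂ (Finsupp.single i 1), fun v => ?_⟩
  ext i
  change MvPolynomial.coeff (Finsupp.single i 1) (∑ j, MvPolynomial.C (v j) * MvPolynomial.X j) =
    v i
  fin_cases i <;> simp [MvPolynomial.coeff_C_mul, MvPolynomial.coeff_X,
    Finsupp.single_left_inj]

theorem Gam_one_eq : Gam 1 = LinearMap.range prSec := by
  refine le_antisymm ?_ (by rintro _ ⟨v, rfl⟩; exact prSec_mem_Gam v)
  obtain ⟨f, hf⟩ := exists_linForm_leftInverse
  -- By multiplicity one, a single intertwiner with nonzero value at `x0` suffices; here `f` reads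
  -- off the linear coefficients.
  have hΨ : IsIntertwiner (2 * 0 + 1) (prSec ∘ₗ f) := fun g p hp => by
    obtain ⟨v, hv⟩ := linForm_bijective.2 ⟨p, hp⟩
    obtain rfl : (linForm v : MvPolynomial (Fin 2) ℂ) = p := congrArg Subtype.val hv
    have h : symAlgAct g (linForm v : MvPolynomial (Fin 2) ℂ) = linForm (g • v) :=
      congrArg Subtype.val (symRep_linForm g v)
    rw [h, LinearMap.comp_apply, LinearMap.comp_apply, hf, hf, secAct_prSec]
  have hm : mon (0 + 1) 0 = linForm (EuclideanSpace.single 0 1) := by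
    simp [mon, linForm]
  refine (Gam_succ_le_map (k := 0) hΨ ?_).trans ?_
  · rw [hm, LinearMap.comp_apply, hf, eval_prSec, ← Submodule.starProjection_apply,
      Submodule.starProjection_eq_self_iff.mpr]
    · simp
    · rw [x0, fiber_mk]
      exact Submodule.mem_span_singleton_self _
  · rintro _ ⟨p, -, rfl⟩
    exact ⟨f p, rfl⟩

/-! ### Equivariant maps from `S³`, `S⁵`, `S⁷`, `S⁹` to `ℂ²` -/

-- Up to a scalar, `T` sends `X 0` to `a X 0 + X 1` and `X 1` to `X 0 - a X 1` with `a = ε + ε⁴`;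
-- these expansions give the images of the monomials used below.
open MvPolynomial in
theorem expand_3_0 (a : ℂ) :
    ((C a * X 0 + X 1) ^ 3 * (X 0 - C a * X 1) ^ 0 : MvPolynomial (Fin 2) ℂ) =
      (a ^ 3) • mon 3 0 + (3 * a ^ 2) • mon 2 1 + (3 * a) • mon 1 2 + (1) • mon 0 3 := by
  simp only [mon, smul_eq_C_mul, map_mul, map_pow, map_ofNat]
  ring

open MvPolynomial in
theorem expand_5_0 (a : ℂ) :
    ((C a * X 0 + X 1) ^ 5 * (X 0 - C a * X 1) ^ 0 : MvPolynomial (Fin 2) ℂ) =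
      (a ^ 5) • mon 5 0 + (5 * a ^ 4) • mon 4 1 + (10 * a ^ 3) • mon 3 2 + (10 * a ^ 2) • mon 2
      3 + (5 * a) • mon 1 4 + (1) • mon 0 5 := by
  simp only [mon, smul_eq_C_mul, map_mul, map_pow, map_ofNat]
  ring

open MvPolynomial in
theorem expand_7_0 (a : ℂ) :
    ((C a * X 0 + X 1) ^ 7 * (X 0 - C a * X 1) ^ 0 : MvPolynomial (Fin 2) ℂ) =
      (a ^ 7) • mon 7 0 + (7 * a ^ 6) • mon 6 1 + (21 * a ^ 5) • mon 5 2 + (35 * a ^ 4) • mon 4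
      3 + (35 * a ^ 3) • mon 3 4 + (21 * a ^ 2) • mon 2 5 + (7 * a) • mon 1 6 + (1) • mon 0 7 := by
  simp only [mon, smul_eq_C_mul, map_mul, map_pow, map_ofNat]
  ring

open MvPolynomial in
theorem expand_8_1 (a : ℂ) :
    ((C a * X 0 + X 1) ^ 8 * (X 0 - C a * X 1) ^ 1 : MvPolynomial (Fin 2) ℂ) =
      (a ^ 8) • mon 9 0 + (8 * a ^ 7 - a ^ 9) • mon 8 1 + (28 * a ^ 6 - 8 * a ^ 8) • mon 7 2 +
      (56 * a ^ 5 - 28 * a ^ 7) • mon 6 3 + (70 * a ^ 4 - 56 * a ^ 6) • mon 5 4 + (56 * a ^ 3 -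
      70 * a ^ 5) • mon 4 5 + (28 * a ^ 2 - 56 * a ^ 4) • mon 3 6 + (8 * a - 28 * a ^ 3) • mon 2
      7 + (1 - 8 * a ^ 2) • mon 1 8 + (-a) • mon 0 9 := by
  simp only [mon, smul_eq_C_mul, map_sub, map_neg, map_mul, map_pow, map_ofNat, map_one]
  ring

open MvPolynomial in
theorem expand_7_2 (a : ℂ) :
    ((C a * X 0 + X 1) ^ 7 * (X 0 - C a * X 1) ^ 2 : MvPolynomial (Fin 2) ℂ) =
      (a ^ 7) • mon 9 0 + (7 * a ^ 6 - 2 * a ^ 8) • mon 8 1 + (21 * a ^ 5 - 14 * a ^ 7 + a ^ 9)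
      • mon 7 2 + (35 * a ^ 4 - 42 * a ^ 6 + 7 * a ^ 8) • mon 6 3 + (35 * a ^ 3 - 70 * a ^ 5 +
      21 * a ^ 7) • mon 5 4 + (21 * a ^ 2 - 70 * a ^ 4 + 35 * a ^ 6) • mon 4 5 + (7 * a - 42 * a
      ^ 3 + 35 * a ^ 5) • mon 3 6 + (1 - 14 * a ^ 2 + 21 * a ^ 4) • mon 2 7 + (-2 * a + 7 * a ^
      3) • mon 1 8 + (a ^ 2) • mon 0 9 := by
  simp only [mon, smul_eq_C_mul, map_add, map_sub, map_neg, map_mul, map_pow, map_ofNat, map_one]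
  ring

section Equivariant

variable {ε : ℂ} {hε : IsPrimitiveRoot ε 5} {n : ℕ} {B : MvPolynomial (Fin 2) ℂ →ₗ[ℂ] C2}

/-- `S` multiplies `mon i j` by `ε^(3i+2j)` and the first coordinate of `ℂ²` by `ε³`. -/
theorem coe_mon_zero_eq_zero
    (hS : ∀ p, p.IsHomogeneous n → B (symAlgAct (icosaS ε hε) p) = icosaS ε hε • B p)
    {i j : ℕ} (hij : i + j = n) (h : (3 * i + 2 * j) % 5 ≠ 3) : B (mon i j) 0 = 0 := by
  have h1 := hS (mon i j) (hij ▸ mon_isHomogeneous i j)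
  rw [symAlgAct_mon_of_diagonal _ rfl rfl, map_smul, smul_def, coe_icosaS] at h1
  have h2 := congrArg (fun v : C2 => v 0) h1
  simp [Matrix.vecHead, ← pow_mul, ← pow_add] at h2
  by_contra h0
  have h3 := h2.resolve_right h0
  rw [← Nat.mod_add_div (3 * i + 2 * j) 5, pow_add, pow_mul, hε.pow_eq_one, one_pow, mul_one] at h3
  exact h (hε.pow_inj (Nat.mod_lt _ (by norm_num)) (by norm_num) h3)

theorem coe_mon_one_eq_zero
    (hS : ∀ p, p.IsHomogeneous n → B (symAlgAct (icosaS ε hε) p) = icosaS ε hε • B p)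
    {i j : ℕ} (hij : i + j = n) (h : (3 * i + 2 * j) % 5 ≠ 2) : B (mon i j) 1 = 0 := by
  have h1 := hS (mon i j) (hij ▸ mon_isHomogeneous i j)
  rw [symAlgAct_mon_of_diagonal _ rfl rfl, map_smul, smul_def, coe_icosaS] at h1
  have h2 := congrArg (fun v : C2 => v 1) h1
  simp [Matrix.vecHead, Matrix.vecTail, ← pow_mul, ← pow_add] at h2
  by_contra h0
  have h3 := h2.resolve_right h0
  rw [← Nat.mod_add_div (3 * i + 2 * j) 5, pow_add, pow_mul, hε.pow_eq_one, one_pow, mul_one] at h3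
  exact h (hε.pow_inj (Nat.mod_lt _ (by norm_num)) (by norm_num) h3)

-- A monomial of the wrong weight for both coordinates is killed by `B`; so is its image under `T`,
-- which gives a linear relation among the surviving coefficients.
open MvPolynomial in
theorem map_expand_eq_zero
    (hS : ∀ p, p.IsHomogeneous n → B (symAlgAct (icosaS ε hε) p) = icosaS ε hε • B p)
    (hT : ∀ p, p.IsHomogeneous n → B (symAlgAct (icosaT ε hε) p) = icosaT ε hε • B p)
    {i j : ℕ} (hij : i + j = n) (h3 : (3 * i + 2 * j) % 5 ≠ 3) (h2 : (3 * i + 2 * j) % 5 ≠ 2) :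
    B ((C (ε + ε ^ 4) * X 0 + X 1) ^ i * (X 0 - C (ε + ε ^ 4) * X 1) ^ j) = 0 := by
  have h0 : B (mon i j) = 0 := by
    ext q
    fin_cases q
    exacts [coe_mon_zero_eq_zero hS hij h3, coe_mon_one_eq_zero hS hij h2]
  have h1 := hT (mon i j) (hij ▸ mon_isHomogeneous i j)
  rw [h0, symAlgAct_mon, coe_icosaT] at h1
  have hc : 1 / (ε ^ 2 - ε ^ 3) ≠ 0 := one_div_ne_zero (sub_ne_zero_of_primitive hε)
  generalize 1 / (ε ^ 2 - ε ^ 3) = c at hc h1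
  generalize ε + ε ^ 4 = a at h1 ⊢
  simp only [Matrix.of_apply, Matrix.cons_val', Matrix.cons_val_zero, Matrix.cons_val_one,
    Matrix.cons_val_fin_one] at h1
  have h4 : (C (c * a) * X 0 + C c * X 1) ^ i * (C c * X 0 + C (-(c * a)) * X 1) ^ j =
      c ^ (i + j) • ((C a * X 0 + X 1) ^ i * (X 0 - C a * X 1) ^ j :
        MvPolynomial (Fin 2) ℂ) := by
    have e1 : (C (c * a) * X 0 + C c * X 1 : MvPolynomial (Fin 2) ℂ) =
        C c * (C a * X 0 + X 1) := by rw [map_mul]; ring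
    have e2 : (C c * X 0 + C (-(c * a)) * X 1 : MvPolynomial (Fin 2) ℂ) =
        C c * (X 0 - C a * X 1) := by rw [map_neg, map_mul]; ring
    rw [e1, e2, smul_eq_C_mul, mul_pow, mul_pow, map_pow]
    ring
  rw [h4, map_smul] at h1
  exact (smul_eq_zero.mp (h1.trans (smul_zero _))).resolve_left (pow_ne_zero _ hc)

/-- Weights leave one unknown per coordinate, on `mon 2 1` and `mon 1 2`, and one relation kills
both since `a ≠ 0`. Degrees 5 and 7 work alike, with `mon 3 2`, `mon 2 3` and `mon 4 3`, `mon 3 4`.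
-/
theorem map_eq_zero_of_equivariant_three {B : MvPolynomial (Fin 2) ℂ →ₗ[ℂ] C2}
    (hS : ∀ p, p.IsHomogeneous 3 → B (symAlgAct (icosaS ε hε) p) = icosaS ε hε • B p)
    (hT : ∀ p, p.IsHomogeneous 3 → B (symAlgAct (icosaT ε hε) p) = icosaT ε hε • B p)
    {p : MvPolynomial (Fin 2) ℂ} (hp : p.IsHomogeneous 3) : B p = 0 := by
  have z0 := @coe_mon_zero_eq_zero ε hε 3 B hS
  have z1 := @coe_mon_one_eq_zero ε hε 3 B hS
  have ha := golden_ne_zero hε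
  have h := map_expand_eq_zero hS hT (i := 3) (j := 0) (by norm_num) (by norm_num) (by norm_num)
  generalize ε + ε ^ 4 = a at ha h
  rw [expand_3_0] at h
  simp only [map_add, map_smul] at h
  have h0 := congrArg (fun v : C2 => v 0) h
  have h1 := congrArg (fun v : C2 => v 1) h
  simp [z0, z1, ha] at h0 h1
  refine eq_zero_of_forall_mon B (fun i j hij => ?_) hp
  have hi : i ≤ 3 := by omega
  obtain rfl : j = 3 - i := by omega
  ext q
  interval_cases i <;> fin_cases q <;> simp [h0, h1, z0, z1]

theorem map_eq_zero_of_equivariant_five {B : MvPolynomial (Fin 2) ℂ →ₗ[ℂ] C2}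
    (hS : ∀ p, p.IsHomogeneous 5 → B (symAlgAct (icosaS ε hε) p) = icosaS ε hε • B p)
    (hT : ∀ p, p.IsHomogeneous 5 → B (symAlgAct (icosaT ε hε) p) = icosaT ε hε • B p)
    {p : MvPolynomial (Fin 2) ℂ} (hp : p.IsHomogeneous 5) : B p = 0 := by
  have z0 := @coe_mon_zero_eq_zero ε hε 5 B hS
  have z1 := @coe_mon_one_eq_zero ε hε 5 B hS
  have ha := golden_ne_zero hε
  have h := map_expand_eq_zero hS hT (i := 5) (j := 0) (by norm_num) (by norm_num) (by norm_num)
  generalize ε + ε ^ 4 = a at ha h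
  rw [expand_5_0] at h
  simp only [map_add, map_smul] at h
  have h0 := congrArg (fun v : C2 => v 0) h
  have h1 := congrArg (fun v : C2 => v 1) h
  simp [z0, z1, ha] at h0 h1
  refine eq_zero_of_forall_mon B (fun i j hij => ?_) hp
  have hi : i ≤ 5 := by omega
  obtain rfl : j = 5 - i := by omega
  ext q
  interval_cases i <;> fin_cases q <;> simp [h0, h1, z0, z1]

theorem map_eq_zero_of_equivariant_seven {B : MvPolynomial (Fin 2) ℂ →ₗ[ℂ] C2}
    (hS : ∀ p, p.IsHomogeneous 7 → B (symAlgAct (icosaS ε hε) p) = icosaS ε hε • B p)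
    (hT : ∀ p, p.IsHomogeneous 7 → B (symAlgAct (icosaT ε hε) p) = icosaT ε hε • B p)
    {p : MvPolynomial (Fin 2) ℂ} (hp : p.IsHomogeneous 7) : B p = 0 := by
  have z0 := @coe_mon_zero_eq_zero ε hε 7 B hS
  have z1 := @coe_mon_one_eq_zero ε hε 7 B hS
  have ha := golden_ne_zero hε
  have h := map_expand_eq_zero hS hT (i := 7) (j := 0) (by norm_num) (by norm_num) (by norm_num)
  generalize ε + ε ^ 4 = a at ha h
  rw [expand_7_0] at h
  simp only [map_add, map_smul] at h
  have h0 := congrArg (fun v : C2 => v 0) h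
  have h1 := congrArg (fun v : C2 => v 1) h
  simp [z0, z1, ha] at h0 h1
  refine eq_zero_of_forall_mon B (fun i j hij => ?_) hp
  have hi : i ≤ 7 := by omega
  obtain rfl : j = 7 - i := by omega
  ext q
  interval_cases i <;> fin_cases q <;> simp [h0, h1, z0, z1]

/-- Here two unknowns per coordinate survive, on `mon 5 4`, `mon 0 9` and on `mon 4 5`, `mon 9 0`,
so two relations are needed. -/
theorem map_eq_zero_of_equivariant_nine {B : MvPolynomial (Fin 2) ℂ →ₗ[ℂ] C2}
    (hS : ∀ p, p.IsHomogeneous 9 → B (symAlgAct (icosaS ε hε) p) = icosaS ε hε • B p)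
    (hT : ∀ p, p.IsHomogeneous 9 → B (symAlgAct (icosaT ε hε) p) = icosaT ε hε • B p)
    {p : MvPolynomial (Fin 2) ℂ} (hp : p.IsHomogeneous 9) : B p = 0 := by
  have z0 := @coe_mon_zero_eq_zero ε hε 9 B hS
  have z1 := @coe_mon_one_eq_zero ε hε 9 B hS
  have ha := golden_ne_zero hε
  have hsq := golden_sq hε
  have h := map_expand_eq_zero hS hT (i := 8) (j := 1) (by norm_num) (by norm_num) (by norm_num)
  have k := map_expand_eq_zero hS hT (i := 7) (j := 2) (by norm_num) (by norm_num) (by norm_num)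
  generalize ε + ε ^ 4 = a at ha h k hsq
  rw [expand_8_1] at h
  rw [expand_7_2] at k
  simp only [map_add, map_smul] at h k
  have h0 := congrArg (fun v : C2 => v 0) h
  have h1 := congrArg (fun v : C2 => v 1) h
  have k0 := congrArg (fun v : C2 => v 0) k
  have k1 := congrArg (fun v : C2 => v 1) k
  simp [z0, z1] at h0 h1 k0 k1
  -- The coefficient left on `mon 5 4`, respectively `mon 4 5`, after eliminating the other unknown.
  -- As `a⁴ = 2 - 3a`, its vanishing would give `a = 1/3`.
  have hne : 35 * a ^ 3 * (1 - a ^ 4) ≠ 0 := by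
    refine mul_ne_zero (by simp [ha]) fun h4 => ?_
    have : a = 1 / 3 := by linear_combination (h4 + (a ^ 2 - a + 2) * hsq) / 3
    rw [this] at hsq
    norm_num at hsq
  have h54 : B (mon 5 4) 0 = 0 := by
    refine (mul_eq_zero.mp ?_).resolve_left hne
    linear_combination a * h0 + k0
  have h45 : B (mon 4 5) 1 = 0 := by
    refine (mul_eq_zero.mp ?_).resolve_left hne
    linear_combination h1 - a * k1
  simp [h54, h45, ha] at h0 h1
  refine eq_zero_of_forall_mon B (fun i j hij => ?_) hp
  have hi : i ≤ 9 := by omega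
  obtain rfl : j = 9 - i := by omega
  ext q
  interval_cases i <;> fin_cases q <;> simp [h0, h1, h54, h45, z0, z1]

end Equivariant

/-! ### The averaging operator on `H` -/

section Average

variable {ε : ℂ} (hε : IsPrimitiveRoot ε 5) [Fintype (icosa ε hε)]

/-- Composing `orbitEval` with an intertwiner gives a `G`-equivariant map from degree 3, 5, 7 or 9
to `ℂ²`. -/
theorem Gam_le_ker_orbitEval {k : ℕ} (hk : k ∈ Finset.Icc 2 5) :
    Gam k ≤ LinearMap.ker (orbitEval (icosa ε hε)) := by
  refine Gam_le fun Φ hΦ p hp => ?_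
  rw [LinearMap.mem_ker, ← LinearMap.comp_apply]
  have hB {g : SU2} (hg : g ∈ icosa ε hε) : ∀ p, p.IsHomogeneous (2 * k - 1) →
      (orbitEval (icosa ε hε) ∘ₗ Φ) (symAlgAct g p) = g • (orbitEval (icosa ε hε) ∘ₗ Φ) p :=
    fun p hp => by
      rw [LinearMap.comp_apply, hΦ g p hp, orbitEval_secAct (icosa ε hε) ⟨g, hg⟩]
      rfl
  have hS := hB (icosaS_mem hε)
  have hT := hB (icosaT_mem hε)
  obtain ⟨h2, h5⟩ := Finset.mem_Icc.mp hk
  clear hΦ hk hB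
  interval_cases k
  exacts [map_eq_zero_of_equivariant_three hS hT hp, map_eq_zero_of_equivariant_five hS hT hp,
    map_eq_zero_of_equivariant_seven hS hT hp, map_eq_zero_of_equivariant_nine hS hT hp]

theorem Hhigh_le_ker_orbitEval : Hhigh ≤ LinearMap.ker (orbitEval (icosa ε hε)) :=
  iSup₂_le fun _ hk => Gam_le_ker_orbitEval hε hk

theorem norm_smul_single_zero (g : SU2) : ‖g • (EuclideanSpace.single 0 1 : C2)‖ = 1 := by
  rw [norm_eq_sqrt_re_inner (𝕜 := ℂ), inner_smul_smul, ← norm_eq_sqrt_re_inner]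
  simp

theorem eval_smul_x0_prSec (g : SU2) (v : C2) :
    (eval (g • x0) (prSec v) : C2) =
      inner ℂ (g • (EuclideanSpace.single 0 1 : C2)) v • g • (EuclideanSpace.single 0 1 : C2) := by
  rw [eval_prSec, ← Submodule.starProjection_apply, x0, smul_mk]
  simp only [fiber_mk]
  exact Submodule.starProjection_unit_singleton ℂ (norm_smul_single_zero g) v

/-- The trace of the orthogonal projection onto a line. -/
theorem trace_eval_smul_x0_prSec (g : SU2) :
    (eval (g • x0) (prSec (EuclideanSpace.single 0 1)) : C2) 0 +
      (eval (g • x0) (prSec (EuclideanSpace.single 1 1)) : C2) 1 = 1 := by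
  have h : inner ℂ (g • (EuclideanSpace.single 0 1 : C2)) (g • EuclideanSpace.single 0 1) =
      (1 : ℂ) := by
    rw [inner_self_eq_norm_sq_to_K, norm_smul_single_zero]
    norm_num
  rw [eval_smul_x0_prSec, eval_smul_x0_prSec]
  rw [smul_single_zero, PiLp.inner_apply, Fin.sum_univ_two, RCLike.inner_apply,
    RCLike.inner_apply] at *
  simp [PiLp.inner_apply] at h ⊢
  linear_combination h

theorem orbitEval_prSec (v : C2) : orbitEval (icosa ε hε) (prSec v) = (60 : ℂ) • v := by
  have hM {g : SU2} (hg : g ∈ icosa ε hε) (v : C2) :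
      orbitEval (icosa ε hε) (prSec (g • v)) = g • orbitEval (icosa ε hε) (prSec v) := by
    rw [← secAct_prSec, orbitEval_secAct (icosa ε hε) ⟨g, hg⟩]
  have hS := hM (icosaS_mem hε) (EuclideanSpace.single 0 1)
  have hU := hM (icosaU_mem hε) (EuclideanSpace.single 0 1)
  have hSe : icosaS ε hε • (EuclideanSpace.single 0 1 : C2) =
      ε ^ 3 • EuclideanSpace.single 0 1 := by
    rw [smul_single_zero, coe_icosaS]
    ext i
    fin_cases i <;> simp
  have hUe : icosaU • (EuclideanSpace.single 0 1 : C2) = -EuclideanSpace.single 1 1 := by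
    rw [smul_single_zero, coe_icosaU]
    ext i
    fin_cases i <;> simp
  rw [hSe, map_smul, map_smul] at hS
  rw [hUe, map_neg, map_neg] at hU
  have hS1 := congrArg (fun w : C2 => w 1) hS
  have hU0 := congrArg (fun w : C2 => w 0) hU
  have hU1 := congrArg (fun w : C2 => w 1) hU
  simp [smul_def, coe_icosaS, coe_icosaU, Matrix.vecHead, Matrix.vecTail] at hS1 hU0 hU1
  -- Commuting with `S`, whose eigenvalues `ε³` and `ε²` differ, kills the off-diagonal entry; `U`
  -- makes the diagonal entries equal, and the trace 120 makes each of them 60.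
  have h01 : (orbitEval (icosa ε hε) (prSec (EuclideanSpace.single 0 1))) 1 = 0 := by
    by_contra hne
    have h1 : ε ^ 3 = ε ^ 2 := mul_right_cancel₀ hne (by simpa using hS1)
    exact absurd (hε.pow_inj (by norm_num) (by norm_num) h1) (by norm_num)
  have htr : (orbitEval (icosa ε hε) (prSec (EuclideanSpace.single 0 1))) 0 +
      (orbitEval (icosa ε hε) (prSec (EuclideanSpace.single 1 1))) 1 = 120 := by
    rw [orbitEval_apply, orbitEval_apply, WithLp.ofLp_sum, WithLp.ofLp_sum, Finset.sum_apply,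
      Finset.sum_apply, ← Finset.sum_add_distrib]
    simp only [trace_eval_smul_x0_prSec]
    rw [Finset.sum_const, Finset.card_univ, ← Nat.card_eq_fintype_card, card_icosa]
    norm_num
  rw [hU1] at htr
  have h00 : (orbitEval (icosa ε hε) (prSec (EuclideanSpace.single 0 1))) 0 = 60 := by
    linear_combination htr / 2
  have h10 : (orbitEval (icosa ε hε) (prSec (EuclideanSpace.single 1 1))) 0 = 0 := by
    linear_combination -hU0 - h01
  have hv : v = v 0 • EuclideanSpace.single 0 1 + v 1 • EuclideanSpace.single 1 1 := by
    ext i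
    fin_cases i <;> simp
  rw [hv, map_add, map_add, map_smul, map_smul, map_smul, map_smul]
  ext i
  fin_cases i <;> simp [h01, h00, hU1, h10, mul_comm]

end Average

/-! ### The decomposition of `H`, the projection `τ` and the trace -/

theorem Gam_one_sup_Hhigh : Gam 1 ⊔ Hhigh = Hsp := by
  rw [Hsp, Hhigh, show Finset.Icc 1 5 = insert 1 (Finset.Icc 2 5) from rfl,
    Finset.iSup_insert]

/-- `orbitEval` separates the summands: it is injective on `Γ²` and zero on `Hhigh`. -/
theorem isCompl_Gam_one_Hhigh {ε : ℂ} (hε : IsPrimitiveRoot ε 5) :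
    IsCompl ((Gam 1).submoduleOf Hsp) (Hhigh.submoduleOf Hsp) := by
  have : Finite (icosa ε hε) := Nat.finite_of_card_ne_zero (by rw [card_icosa]; norm_num)
  have := Fintype.ofFinite (icosa ε hε)
  constructor
  · rw [Submodule.disjoint_def]
    intro s hs hs'
    have hs : (s : Sec) ∈ Gam 1 := hs
    have hs' := Hhigh_le_ker_orbitEval hε (show (s : Sec) ∈ Hhigh from hs')
    rw [Gam_one_eq] at hs
    obtain ⟨v, hv⟩ := hs
    rw [LinearMap.mem_ker, ← hv, orbitEval_prSec, smul_eq_zero] at hs'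
    apply Subtype.ext
    rw [← hv, hs'.resolve_left (by norm_num), map_zero]
    rfl
  · rw [codisjoint_iff, eq_top_iff]
    rintro ⟨s, hs⟩ -
    obtain ⟨t, ht, u, hu, rfl⟩ := Submodule.mem_sup.mp (Gam_one_sup_Hhigh.ge hs)
    exact Submodule.mem_sup.mpr ⟨⟨t, Gam_one_le ht⟩, ht,
      ⟨u, Gam_one_sup_Hhigh.le (Submodule.mem_sup_right hu)⟩, hu, rfl⟩

/-- On `Γ²` the right side is multiplication by `2 * 60 / 120 = 1`, and on `Hhigh` it is zero. -/
theorem tau_eq {ε : ℂ} (hε : IsPrimitiveRoot ε 5) [Fintype (icosa ε hε)]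
    (h : IsCompl ((Gam 1).submoduleOf Hsp) (Hhigh.submoduleOf Hsp)) (s : Hsp) :
    tau h s = (1 / 120 : ℂ) •
      ∑ g : icosa ε hε, twoPr ((g : SU2) • x0) (eval ((g : SU2) • x0) (s : Sec)) := by
  obtain ⟨t, ht, u, hu, rfl⟩ : ∃ t ∈ (Gam 1).submoduleOf Hsp, ∃ u ∈ Hhigh.submoduleOf Hsp,
      t + u = s := Submodule.mem_sup.mp (h.sup_eq_top ▸ Submodule.mem_top)
  have h1 : (tau h (t + u) : Sec) = t := by
    rw [map_add]
    have e1 : tau h t = Submodule.submoduleOfEquivOfLe Gam_one_le ⟨t, ht⟩ := by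
      change Submodule.submoduleOfEquivOfLe Gam_one_le (Submodule.projectionOnto _ _ h t) = _
      rw [Submodule.projectionOnto_apply_left h ⟨t, ht⟩]
    have e2 : tau h u = 0 := by
      change Submodule.submoduleOfEquivOfLe Gam_one_le (Submodule.projectionOnto _ _ h u) = _
      rw [Submodule.projectionOnto_apply_right h ⟨u, hu⟩, map_zero]
    rw [e1, e2, add_zero]
    rfl
  apply Subtype.ext
  rw [h1, Submodule.coe_smul, sum_twoPr, Submodule.coe_add, map_add,
    LinearMap.mem_ker.mp (Hhigh_le_ker_orbitEval hε (show (u : Sec) ∈ Hhigh from hu)), add_zero]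
  have ht : (t : Sec) ∈ Gam 1 := ht
  rw [Gam_one_eq] at ht
  obtain ⟨v, hv⟩ := ht
  rw [← hv, orbitEval_prSec, map_smul, smul_smul, smul_smul]
  norm_num

/-- By `tr(AB) = tr(BA)` the trace moves to the line `x0`, where evaluation after `lam0` is
multiplication by 2. -/
theorem trace_PsiEnd_single_x0 : LinearMap.trace ℂ Hsp (DPair.single x0 lam0).PsiEnd = 2 := by
  have h1 : (DPair.single x0 lam0).PsiEnd =
      (Submodule.inclusion Gam_one_le ∘ₗ lam0) ∘ₗ (eval x0 ∘ₗ Hsp.subtype) := by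
    refine LinearMap.ext fun s => Subtype.ext ?_
    have h := Finset.sum_coe_sort {x0} fun y => twoPr y (eval y (s : Sec))
    rw [Finset.sum_singleton] at h
    change ((∑ y : (DPair.single x0 lam0).X,
      (DPair.single x0 lam0).lam y ∘ₗ eval y) (s : Sec) : Sec) = _
    rw [LinearMap.sum_apply]
    exact congrArg Subtype.val h
  have h2 : (eval x0 ∘ₗ Hsp.subtype) ∘ₗ (Submodule.inclusion Gam_one_le ∘ₗ lam0) =
      (2 : ℂ) • LinearMap.id := by
    refine LinearMap.ext fun z => Subtype.ext ?_
    change (eval x0 ((2 : ℂ) • prSec z) : C2) = (2 : ℂ) • (z : C2)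
    rw [map_smul, Submodule.coe_smul, eval_prSec, ← Submodule.starProjection_apply,
      Submodule.starProjection_eq_self_iff.mpr z.2]
  have h3 : Module.finrank ℂ (fiber x0) = 1 := Projectivization.finrank_submodule x0
  have : Module.Free ℂ Hsp := Module.Free.of_divisionRing ℂ Hsp
  have h4 := LinearMap.trace_comp_comm' (R := ℂ) (M := fiber x0) (N := Hsp)
    (Submodule.inclusion Gam_one_le ∘ₗ lam0)
    (eval x0 ∘ₗ Hsp.subtype)
  rw [h1, ← h4, h2, map_smul, LinearMap.trace_id, h3]
  norm_num

end TauDesign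

end

theorem mainTheorem2 (ε : ℂ) (hε : IsPrimitiveRoot ε 5) :
    -- the trace of `Ψ` for the pair `({x₀}, λ₀)`
    LinearMap.trace ℂ Hsp (DPair.single x0 lam0).PsiEnd = 2 ∧
    -- the group, the stabilizer of `x₀`, and its action on `λ₀`
    Nat.card (icosa ε hε) = 120 ∧
    Nat.card (MulAction.stabilizer (icosa ε hε) x0) = 10 ∧
    (∀ k : icosa ε hε, (k : SU2) • x0 = x0 →
      ∀ (z : C2) (hz : z ∈ fiber x0) (hz' : z ∈ fiber ((k : SU2) • x0)),
        actLam (k : SU2) lam0 ⟨z, hz'⟩ = lam0 ⟨z, hz⟩) ∧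
    -- there are 12 representatives of the left cosets of the stabilizer
    (∃ g : Fin 12 → icosa ε hε, Function.Bijective fun i =>
      (g i : icosa ε hε ⧸ MulAction.stabilizer (icosa ε hε) x0)) ∧
    -- `τ` is well defined
    ∃ h : IsCompl ((Gam 1).submoduleOf Hsp) (Hhigh.submoduleOf Hsp),
      -- the averaged orbit sum of `({x₀}, λ₀)` is a `τ`-design
      (icosaPair ε hε).IsDesign (tau h) ∧
      (∀ s : Hsp, tau h s =
        (1 / 120 : ℂ) • ∑ᶠ g : icosa ε hε,
          actLam (g : SU2) lam0 (eval ((g : SU2) • x0) (s : Sec))) ∧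
      -- reduction to the 12 points `x_i = g_i x₀` and the maps `λ_i = g_i • λ₀`
      ∀ g : Fin 12 → icosa ε hε,
        (Function.Bijective fun i =>
          (g i : icosa ε hε ⧸ MulAction.stabilizer (icosa ε hε) x0)) →
        (Function.Injective fun i => (g i : SU2) • x0) ∧
        (Set.range fun i => (g i : SU2) • x0) = MulAction.orbit (icosa ε hε) x0 ∧
        ((icosaPair ε hε).X : Set CP1) =
          Set.range (fun i => (g i : SU2) • x0) ∧
        (∀ (i : Fin 12) (hi : (g i : SU2) • x0 ∈ (icosaPair ε hε).X),
          (icosaPair ε hε).lam ⟨_, hi⟩ =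
            (1 / 12 : ℂ) • actLam (g i : SU2) lam0) ∧
        ∀ s : Hsp, tau h s =
          (1 / 12 : ℂ) • ∑ i, actLam (g i : SU2) lam0 (eval ((g i : SU2) • x0) (s : Sec)) := by
  have hG := card_icosa hε
  have hS := card_stabilizer hε
  have : Finite (icosa ε hε) := Nat.finite_of_card_ne_zero (by rw [hG]; norm_num)
  have := Fintype.ofFinite (icosa ε hε)
  have hX := mem_icosaPair_X hε
  have hdesign : (icosaPair ε hε).IsDesign (tau (isCompl_Gam_one_Hhigh hε)) := fun s =>
    (tau_eq hε _ s).trans (sum_icosaPair hε hG hS s).symm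
  refine ⟨trace_PsiEnd_single_x0, hG, hS, fun k _ z hz hz' => ?_, ?_,
    isCompl_Gam_one_Hhigh hε, hdesign, fun s => ?_, fun g hg => ?_⟩
  · rw [actLam_lam0]
    rfl
  · have : Finite (icosa ε hε ⧸ MulAction.stabilizer (icosa ε hε) x0) :=
      Nat.finite_of_card_ne_zero (by rw [card_quotient_stabilizer]; norm_num)
    let e := (Finite.equivFinOfCardEq (card_quotient_stabilizer hε)).symm
    refine ⟨fun i => (e i).out, ?_⟩
    convert e.bijective using 1
    funext i
    exact Quotient.out_eq' _
  · rw [tau_eq hε, finsum_eq_sum_of_fintype]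
    simp only [actLam_lam0]
  · have hinj : Function.Injective fun i => (g i : SU2) • x0 := fun i j hij => by
      refine hg.1 (QuotientGroup.eq.mpr ?_)
      rw [MulAction.mem_stabilizer_iff, mul_smul, inv_smul_eq_iff]
      exact hij.symm
    have hrange : (Set.range fun i => (g i : SU2) • x0) = MulAction.orbit (icosa ε hε) x0 := by
      ext y
      constructor
      · rintro ⟨i, rfl⟩
        exact ⟨g i, rfl⟩
      · rintro ⟨k, rfl⟩
        obtain ⟨i, hi⟩ := hg.2 (k : icosa ε hε ⧸ MulAction.stabilizer (icosa ε hε) x0)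
        refine ⟨i, ?_⟩
        have h1 : (g i)⁻¹ * k ∈ MulAction.stabilizer (icosa ε hε) x0 := QuotientGroup.eq.mp hi
        rw [MulAction.mem_stabilizer_iff, mul_smul, inv_smul_eq_iff] at h1
        exact h1.symm
    have hXr : ((icosaPair ε hε).X : Set CP1) = Set.range fun i => (g i : SU2) • x0 := by
      rw [hrange]
      ext y
      exact hX y
    refine ⟨hinj, hrange, hXr, fun i hi => ?_, fun s => ?_⟩
    · rw [icosaPair_lam hε hG hS, actLam_lam0]
    · classical
      have hXi : (icosaPair ε hε).X = Finset.univ.image fun i => (g i : SU2) • x0 := by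
        apply Finset.coe_injective
        rw [hXr, Finset.coe_image, Finset.coe_univ, Set.image_univ]
      -- Each of the twelve points occurs ten times in the sum over `G`, which turns `1 / 120` into
      -- `1 / 12`.
      rw [tau_eq hε, sum_icosa_smul (M := Gam 1) hε hS fun y => twoPr y (eval y (s : Sec)), hXi,
        Finset.sum_image hinj.injOn, ← Nat.cast_smul_eq_nsmul ℂ, smul_smul]
      simp only [actLam_lam0]
      norm_num
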